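/- **Theorem.** Let $n \ge 2$ be even, $d \ge 0$, and $p, q \in [0,1]$. Fix a parallel architecture of depth $d$ on $n$ qubits: for each layer $m = 1,\dots,d$, an arbitrary partition of the qubits into $n/2$ pairs, which may change from layer to layer. Consider the following random noisy circuit. In each layer $m$, an independent Haar-random two-qubit unitary acts on each pair; let $U_m$ be the tensor product of these gates and $\mathcal{C}_m(\rho) = U_m \rho U_m^\dagger$. After each layer, each site is selected independently with probability $p$ (independently of all gates and of all other selections), and at each selected site $i$ the dephasing channel $$\rho \mapsto (1-q)\rho + q\, Z_i \rho Z_i$$ is applied; let $\mathcal{E}_m$ be the resulting noise channel of layer $m$ (the selected locations are regarded as known). For a given realization of the gates and of the noise locations, let $$p_x = \langle x |\, (\mathcal{E}_d \circ \mathcal{C}_d \circ \cdots \circ \mathcal{E}_1 \circ \mathcal{C}_1)(|0^n\rangle\langle 0^n|)\, | x \rangle, \qquad x \in \{0,1\}^n,$$ be the distribution of the outcome of a measurement in the computational basis, and let $$\delta = \frac12 \sum_{x \in \{0,1\}^n} \left| p_x - 2^{-n} \right|$$ be its total variation distance to the uniform distribution on $\{0,1\}^n$. Then the expectation over the gates and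 the noise locations satisfies $$\mathbb{E}[\delta] < \frac{3^{2/3}}{2}\, n^{1/3}\, e^{-\gamma p d/3}, \qquad \text{where } \gamma = \frac{8q(1-q)}{3}.$$ -/

import Mathlib

open MeasureTheory ProbabilityTheory

noncomputable section

namespace NoisyCircuit

/-! ## Two-qubit gates and the Haar probability measure -/

/-- Two-qubit gates: unitary matrices on two qubits, with rows and columns indexed by pairs of
bits. -/
abbrev TwoQubitGate : Type := ↥(Matrix.unitaryGroup (Fin 2 × Fin 2) ℂ)

instance : MeasurableSpace TwoQubitGate := borel TwoQubitGate

instance : BorelSpace TwoQubitGate := ⟨rfl⟩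

instance : SecondCountableTopology TwoQubitGate :=
  haveI : SecondCountableTopology (Matrix (Fin 2 × Fin 2) (Fin 2 × Fin 2) ℂ) :=
    inferInstanceAs (SecondCountableTopology (Fin 2 × Fin 2 → Fin 2 × Fin 2 → ℂ))
  TopologicalSpace.Subtype.secondCountableTopology _

/-- The unitary group is compact: it is a closed subset of a product of discs. -/
instance : CompactSpace TwoQubitGate := by
  apply isCompact_iff_compactSpace.mp
  have hK : IsCompact (Set.univ.pi fun _ : Fin 2 × Fin 2 =>
      Set.univ.pi fun _ : Fin 2 × Fin 2 => Metric.closedBall (0 : ℂ) 1) :=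
    isCompact_univ_pi fun _ => isCompact_univ_pi fun _ => isCompact_closedBall _ _
  have hC : IsClosed ((Matrix.unitaryGroup (Fin 2 × Fin 2) ℂ :
      Submonoid (Matrix (Fin 2 × Fin 2) (Fin 2 × Fin 2) ℂ)) :
        Set (Matrix (Fin 2 × Fin 2) (Fin 2 × Fin 2) ℂ)) := by
    have h : ((Matrix.unitaryGroup (Fin 2 × Fin 2) ℂ :
        Submonoid (Matrix (Fin 2 × Fin 2) (Fin 2 × Fin 2) ℂ)) :
          Set (Matrix (Fin 2 × Fin 2) (Fin 2 × Fin 2) ℂ)) =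
        {A | A * star A = 1} := by
      ext A
      exact Matrix.mem_unitaryGroup_iff
    rw [h]
    exact isClosed_eq (by fun_prop) continuous_const
  refine hK.of_isClosed_subset hC ?_
  intro A hA
  simp only [Set.mem_pi, Set.mem_univ, forall_true_left, Metric.mem_closedBall, dist_zero_right]
  intro i j
  exact entry_norm_bound_of_unitary hA i j

/-- The normalized Haar measure on the group of two-qubit unitaries. -/
def haarGate : Measure TwoQubitGate := Measure.haarMeasure ⊤

instance : IsProbabilityMeasure haarGate := by
  refine ⟨?_⟩
  have h := Measure.haarMeasure_self (K₀ := (⊤ : TopologicalSpace.PositiveCompacts TwoQubitGate))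
  simpa [haarGate] using h

/-! ## Architectures, gates and noise -/

/-- A parallel architecture of depth `d` on `n` qubits. In each layer `m` the set of all qubits is
partitioned into `n / 2` pairs: pair number `g` consists of the qubits `site m (g, 0)` and
`site m (g, 1)`, and a two-qubit gate acts on each pair. The pairing is arbitrary and may change
from layer to layer. Such a partition exists only if `n` is even. -/
structure ParallelArchitecture (n d : ℕ) where
  site : Fin d → (Fin (n / 2) × Fin 2 ≃ Fin n)

/-- Bit strings of length `n`; they label the computational basis. -/
abbrev Bits (n : ℕ) : Type := Fin n → Fin 2

/-- Operators on `n` qubits, as matrices in the computational basis. -/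
abbrev QMatrix (n : ℕ) : Type := Matrix (Bits n) (Bits n) ℂ

/-- The tensor product over all pairs `g` of the two-qubit gate `u g`, acting on the qubits
`e (g, 0)` and `e (g, 1)`. -/
def layerUnitary {n : ℕ} (e : Fin (n / 2) × Fin 2 ≃ Fin n) (u : Fin (n / 2) → TwoQubitGate) :
    QMatrix n :=
  Matrix.of fun x y => ∏ g, (u g : Matrix (Fin 2 × Fin 2) (Fin 2 × Fin 2) ℂ)
    (x (e (g, 0)), x (e (g, 1))) (y (e (g, 0)), y (e (g, 1)))

/-- The Pauli operator `Z` on qubit `i`. -/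
def pauliZ {n : ℕ} (i : Fin n) : QMatrix n :=
  Matrix.diagonal fun x => if x i = 0 then 1 else -1

/-- The dephasing channel on qubit `i`: `ρ ↦ (1 - q) ρ + q Zᵢ ρ Zᵢ`. -/
def dephase {n : ℕ} (q : ℝ) (i : Fin n) (ρ : QMatrix n) : QMatrix n :=
  ((1 - q : ℝ) : ℂ) • ρ + (q : ℂ) • (pauliZ i * ρ * pauliZ i)

/-- Dephasing of all the qubits `i` with `L i = true` (these channels commute). -/
def noiseLayer {n : ℕ} (q : ℝ) (L : Fin n → Bool) (ρ : QMatrix n) : QMatrix n :=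
  (List.finRange n).foldl (fun σ i => if L i then dephase q i σ else σ) ρ

/-- The initial state, the projection onto the computational basis state `00…0`. -/
def zeroState (n : ℕ) : QMatrix n := Matrix.single 0 0 1

/-- The gates of a circuit: one two-qubit gate for each layer and each pair of the layer. -/
abbrev Gates (n d : ℕ) : Type := Fin d → Fin (n / 2) → TwoQubitGate

/-- The noise locations of a circuit: the set of dephased sites after each layer. -/
abbrev Locations (n d : ℕ) : Type := Fin d → Fin n → Bool

/-- The output state `(ℰ_d ∘ 𝒞_d ∘ ⋯ ∘ ℰ_1 ∘ 𝒞_1) (|0ⁿ⟩⟨0ⁿ|)`: in each layer first the unitary of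
the layer acts by conjugation, and then the sites selected in this layer are dephased. -/
def outputState {n d : ℕ} (A : ParallelArchitecture n d) (q : ℝ) (u : Gates n d)
    (L : Locations n d) : QMatrix n :=
  (List.finRange d).foldl
    (fun ρ m => noiseLayer q (L m)
      (layerUnitary (A.site m) (u m) * ρ * (layerUnitary (A.site m) (u m)).conjTranspose))
    (zeroState n)

/-- The probability of the outcome `x` when the output state is measured in the computational
basis. -/
def outputProb {n d : ℕ} (A : ParallelArchitecture n d) (q : ℝ) (u : Gates n d)
    (L : Locations n d) (x : Bits n) : ℝ :=
  (outputState A q u L x x).re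

/-- The total variation distance between the output distribution and the uniform distribution on
bit strings of length `n`. -/
def tvDistUniform {n d : ℕ} (A : ParallelArchitecture n d) (q : ℝ) (u : Gates n d)
    (L : Locations n d) : ℝ :=
  (1 / 2) * ∑ x : Bits n, |outputProb A q u L x - 1 / 2 ^ n|

/-! ## The random circuit ensemble -/

/-- All gates are independent and Haar distributed. -/
def gateLaw (n d : ℕ) : Measure (Gates n d) :=
  Measure.pi fun _ => Measure.pi fun _ => haarGate

/-- After each layer, each site is selected independently with probability `p`. -/
def locationLaw (n d : ℕ) (p : unitInterval) : Measure (Locations n d) :=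
  Measure.pi fun _ => Measure.pi fun _ => bernoulliMeasure true false p

/-- The ensemble of noisy circuits with heralded dephasing: gates and noise locations are
independent of each other. -/
def ensemble (n d : ℕ) (p : unitInterval) : Measure (Gates n d × Locations n d) :=
  (gateLaw n d).prod (locationLaw n d p)

instance (n d : ℕ) : IsProbabilityMeasure (gateLaw n d) := by
  unfold gateLaw; infer_instance

instance (n d : ℕ) (p : unitInterval) : IsProbabilityMeasure (locationLaw n d p) := by
  unfold locationLaw; infer_instance

instance (n d : ℕ) (p : unitInterval) : IsProbabilityMeasure (ensemble n d p) := by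
  unfold ensemble; infer_instance

end NoisyCircuit

end

/-!
The proof is a second-moment computation in the basis of Pauli strings.

By the Cauchy–Schwarz inequality, `4 δ² ≤ 2ⁿ ∑ pₓ² - 1`, and by Parseval's identity
(`sum_zIndicator_normSq`) `2ⁿ ∑ pₓ²` is the sum of `|tr (P ρ)|²` over the strings `P` made of `1`
and `Z`. So it suffices to follow the squared coefficients `|tr (P ρ)|²` on average.

* A Haar random gate acts on them linearly, on average: the identity of a pair stays, and each of
  the fifteen nontrivial Pauli matrices of the pair becomes each of the fifteen with equal weight
  (`integral_pauliTransfer_mul`). No Weingarten calculus is needed. If `σ` and `τ` are anticommuting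
  Pauli matrices, then the gate `(σ + τ) / √2` exchanges them, so by left invariance of the Haar
  measure the second moments of all nontrivial rows of the adjoint action coincide, and their sum is
  known because the adjoint action is unitary.
* Heralded dephasing multiplies the squared coefficient of `X` and `Y` by `1 - 3y/2` on average,
  where `y = γ p`, and fixes those of `1` and `Z`.

Hence the mean second moment is a matrix product (`meanTransferMatrix`), which is estimated in
`zIndicator_dotProduct_le`. A layer of noise and then of gates turns the indicator of the strings
supported in a set `T` of sites into a mixture of indicators for unions of pairs. Induction on the
depth bounds the second moment started from such a noisy indicator by `(1 + (1 - y)ᵈ) ^ |T|`. Each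
step of it is the inequality `spread_le` for a single pair, which is why the pairing may be
arbitrary. The input state is dominated by the noisy indicator for all sites, so that the mean
second moment is at most `(1 + (1 - y)ᵈ)ⁿ ≤ exp x`, with `x = n exp (-γ p d)`.

The claimed bound is `r / 2` with `r³ = 9 x`. If `r > 2` it exceeds the trivial bound `δ ≤ 1`.
Otherwise `x < 1`, so `exp x - 1 ≤ 2 x = 2 r³ / 9`, and the inequality of the arithmetic and
geometric means gives `E δ ≤ ((exp x - 1) / r + r) / 4 < r / 2`.
-/

open MeasureTheory ProbabilityTheory

noncomputable section

namespace NoisyCircuit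

open scoped Kronecker ComplexOrder

/-! ### Pauli matrices on one and two qubits -/

/-- The Pauli matrices, in the order `1, X, Y, Z`. -/
def pauli : Fin 4 → Matrix (Fin 2) (Fin 2) ℂ :=
  ![1, !![0, 1; 1, 0], !![0, -Complex.I; Complex.I, 0], !![1, 0; 0, -1]]

lemma pauli_conjTranspose (a : Fin 4) : (pauli a).conjTranspose = pauli a := by
  ext i j
  fin_cases a <;> fin_cases i <;> fin_cases j <;> simp [pauli, Matrix.conjTranspose_apply]

lemma pauli_mul_self (a : Fin 4) : pauli a * pauli a = 1 := by
  ext i j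
  fin_cases a <;> fin_cases i <;> fin_cases j <;>
    simp [pauli, Matrix.mul_apply, Fin.sum_univ_two]

/-- The Pauli matrices divided by `√2` are a complete orthonormal system. -/
lemma pauli_complete (s t s' t' : Fin 2) :
    ∑ a, pauli a s t * pauli a t' s' = if s = s' ∧ t = t' then 2 else 0 := by
  fin_cases s <;> fin_cases t <;> fin_cases s' <;> fin_cases t' <;>
    simp [pauli, Fin.sum_univ_four] <;> norm_num

lemma trace_pauli_mul (a b : Fin 4) :
    (pauli a * pauli b).trace = if a = b then 2 else 0 := by
  fin_cases a <;> fin_cases b <;>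
    simp [pauli, Matrix.trace, Fin.sum_univ_two] <;> norm_num

/-- Whether two Pauli matrices anticommute. -/
abbrev Anticomm (a b : Fin 4) : Prop := a ≠ 0 ∧ b ≠ 0 ∧ a ≠ b

lemma pauli_mul_comm (a b : Fin 4) :
    pauli a * pauli b = (if Anticomm a b then (-1 : ℂ) else 1) • (pauli b * pauli a) := by
  ext i j
  fin_cases a <;> fin_cases b <;> fin_cases i <;> fin_cases j <;>
    simp [pauli, Matrix.mul_apply, Fin.sum_univ_two, Anticomm]

/-- The Pauli matrices on two qubits. -/
def pauli₂ (a : Fin 4 × Fin 4) : Matrix (Fin 2 × Fin 2) (Fin 2 × Fin 2) ℂ :=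
  pauli a.1 ⊗ₖ pauli a.2

lemma pauli₂_zero : pauli₂ 0 = 1 := by
  have h : pauli 0 = 1 := rfl
  simp [pauli₂, h]

lemma pauli₂_conjTranspose (a : Fin 4 × Fin 4) : (pauli₂ a).conjTranspose = pauli₂ a := by
  rw [pauli₂, Matrix.conjTranspose_kronecker, pauli_conjTranspose, pauli_conjTranspose]

lemma pauli₂_mul_self (a : Fin 4 × Fin 4) : pauli₂ a * pauli₂ a = 1 := by
  rw [pauli₂, ← Matrix.mul_kronecker_mul, pauli_mul_self, pauli_mul_self,
    Matrix.one_kronecker_one]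

lemma trace_pauli₂_mul (a b : Fin 4 × Fin 4) :
    (pauli₂ a * pauli₂ b).trace = if a = b then 4 else 0 := by
  rw [pauli₂, pauli₂, ← Matrix.mul_kronecker_mul, Matrix.trace_kronecker, trace_pauli_mul,
    trace_pauli_mul]
  by_cases h1 : a.1 = b.1 <;> by_cases h2 : a.2 = b.2 <;> simp [h1, h2, Prod.ext_iff]
  norm_num

/-- Whether two two-qubit Pauli matrices anticommute: an odd number of tensor factors does. -/
abbrev Anticomm₂ (a b : Fin 4 × Fin 4) : Prop := Xor (Anticomm a.1 b.1) (Anticomm a.2 b.2)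

lemma pauli₂_anticomm {a b : Fin 4 × Fin 4} (h : Anticomm₂ a b) :
    pauli₂ a * pauli₂ b = -(pauli₂ b * pauli₂ a) := by
  rw [pauli₂, pauli₂, ← Matrix.mul_kronecker_mul, ← Matrix.mul_kronecker_mul,
    pauli_mul_comm a.1, pauli_mul_comm a.2, Matrix.smul_kronecker, Matrix.kronecker_smul, smul_smul]
  rcases h with ⟨h1, h2⟩ | ⟨h1, h2⟩ <;> rw [if_pos h1, if_neg h2] <;> simp

/-- Any two nontrivial Pauli matrices, equal or not, anticommute with a common third one. This links
all of them through `pauliSwap`. -/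
lemma exists_anticomm₂ : ∀ a b : Fin 4 × Fin 4, a ≠ 0 → b ≠ 0 →
    ∃ c, Anticomm₂ a c ∧ Anticomm₂ c b := by
  decide +kernel

/-- Every two-qubit operator is a combination of Pauli matrices. -/
lemma sum_trace_pauli₂ (M : Matrix (Fin 2 × Fin 2) (Fin 2 × Fin 2) ℂ) :
    ∑ b, (1 / 4 * (pauli₂ b * M).trace) • pauli₂ b = M := by
  ext s t
  have key : ∀ s' t' : Fin 2 × Fin 2,
      ∑ b, pauli₂ b s t * pauli₂ b t' s' = if s = s' ∧ t = t' then 4 else 0 := by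
    intro s' t'
    simp only [pauli₂, Matrix.kroneckerMap_apply, Fintype.sum_prod_type]
    have : ∀ a b : Fin 4, pauli a s.1 t.1 * pauli b s.2 t.2 *
        (pauli a t'.1 s'.1 * pauli b t'.2 s'.2)
        = (pauli a s.1 t.1 * pauli a t'.1 s'.1) * (pauli b s.2 t.2 * pauli b t'.2 s'.2) := by
      intros; ring
    simp only [this, ← Finset.mul_sum, ← Finset.sum_mul, pauli_complete]
    by_cases h1 : s.1 = s'.1 <;> by_cases h2 : s.2 = s'.2 <;>
    by_cases h3 : t.1 = t'.1 <;> by_cases h4 : t.2 = t'.2 <;>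
      simp [h1, h2, h3, h4, Prod.ext_iff]
    norm_num
  simp only [Matrix.sum_apply, Matrix.smul_apply, Matrix.trace, Matrix.diag, Matrix.mul_apply,
    smul_eq_mul, Finset.mul_sum, Finset.sum_mul]
  rw [Finset.sum_comm]
  simp_rw [Finset.sum_comm (s := (Finset.univ : Finset (Fin 4 × Fin 4)))]
  have : ∀ i j b, 1 / 4 * (pauli₂ b i j * M j i) * pauli₂ b s t
      = (pauli₂ b s t * pauli₂ b i j) * (M j i / 4) := by intros; ring
  simp only [this, ← Finset.sum_mul, key]
  rw [Finset.sum_eq_single t, Finset.sum_eq_single s]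
  · rw [if_pos ⟨rfl, rfl⟩]; ring
  · intro b _ hb; simp [Ne.symm hb]
  · simp
  · intro b _ hb; simp [Ne.symm hb]
  · simp

/-! ### The adjoint action of a gate -/

/-- The matrix of the conjugation `M ↦ u⁻¹ M u` in the basis of two-qubit Pauli matrices. -/
def pauliTransfer (u : TwoQubitGate) (a b : Fin 4 × Fin 4) : ℂ :=
  1 / 4 * (pauli₂ b * (star u.1 * pauli₂ a * u.1)).trace

lemma conj_pauli₂ (u : TwoQubitGate) (a : Fin 4 × Fin 4) :
    star u.1 * pauli₂ a * u.1 = ∑ b, pauliTransfer u a b • pauli₂ b :=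
  (sum_trace_pauli₂ _).symm

/-- The entries of `pauliTransfer u` are real. -/
lemma star_pauliTransfer (u : TwoQubitGate) (a b : Fin 4 × Fin 4) :
    star (pauliTransfer u a b) = pauliTransfer u a b := by
  unfold pauliTransfer
  rw [star_mul', ← Matrix.trace_conjTranspose]
  simp only [Matrix.conjTranspose_mul, pauli₂_conjTranspose, Matrix.star_eq_conjTranspose,
    Matrix.conjTranspose_conjTranspose]
  rw [Matrix.trace_mul_comm (pauli₂ b)]
  simp [Matrix.mul_assoc]

/-- The rows of `pauliTransfer u` are orthonormal, because conjugation by `u` preserves the trace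
inner product. -/
lemma pauliTransfer_mul_star (u : TwoQubitGate) :
    Matrix.of (pauliTransfer u) * star (Matrix.of (pauliTransfer u)) = 1 := by
  ext a a'
  have hu : u.1 * star u.1 = 1 := Matrix.mem_unitaryGroup_iff.1 u.2
  have h : (star u.1 * pauli₂ a * u.1) * (star u.1 * pauli₂ a' * u.1)
      = star u.1 * (pauli₂ a * pauli₂ a') * u.1 := by
    calc _ = star u.1 * pauli₂ a * (u.1 * star u.1) * pauli₂ a' * u.1 := by
          simp only [Matrix.mul_assoc]
      _ = _ := by rw [hu]; simp only [Matrix.mul_assoc, Matrix.one_mul]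
  have h2 := congrArg Matrix.trace h
  rw [Matrix.trace_mul_comm (star u.1 * (pauli₂ a * pauli₂ a')), ← Matrix.mul_assoc u.1, hu,
    Matrix.one_mul, trace_pauli₂_mul, conj_pauli₂ u a, Matrix.sum_mul, Matrix.trace_sum] at h2
  simp only [Matrix.mul_apply, Matrix.star_apply, Matrix.of_apply, star_pauliTransfer,
    Matrix.one_apply]
  have h3 : ∀ b, pauliTransfer u a b * pauliTransfer u a' b
      = 1 / 4 * (pauliTransfer u a b • pauli₂ b * (star u.1 * pauli₂ a' * u.1)).trace := by
    intro b
    rw [Matrix.smul_mul, Matrix.trace_smul, smul_eq_mul]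
    conv_lhs => rw [pauliTransfer.eq_1 u a' b]
    ring
  simp only [h3, ← Finset.mul_sum, h2]
  split_ifs <;> simp

/-- The columns of `pauliTransfer u` are orthonormal, because its rows are. -/
lemma sum_pauliTransfer_mul (u : TwoQubitGate) (b c : Fin 4 × Fin 4) :
    ∑ a, pauliTransfer u a b * pauliTransfer u a c = if b = c then 1 else 0 := by
  have h₀ : star (Matrix.of (pauliTransfer u)) * Matrix.of (pauliTransfer u) = 1 :=
    mul_eq_one_comm.1 (pauliTransfer_mul_star u)
  have h := congrFun (congrFun h₀ b) c
  simpa [Matrix.mul_apply, Matrix.star_apply, star_pauliTransfer, Matrix.one_apply,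
    -RCLike.star_def] using h

/-! ### Second moments of a Haar random gate -/

lemma continuous_pauliTransfer (a b : Fin 4 × Fin 4) :
    Continuous fun u : TwoQubitGate => pauliTransfer u a b := by
  unfold pauliTransfer
  fun_prop

lemma integrable_haarGate_of_continuous {f : TwoQubitGate → ℂ} (hf : Continuous f) :
    Integrable f haarGate :=
  hf.integrable_of_hasCompactSupport (HasCompactSupport.of_compactSpace f)

instance : Measure.IsMulLeftInvariant haarGate :=
  inferInstanceAs (Measure.IsMulLeftInvariant (Measure.haarMeasure ⊤))

lemma inv_sqrt_two_mul_self :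
    ((Real.sqrt 2 : ℝ) : ℂ)⁻¹ * ((Real.sqrt 2 : ℝ) : ℂ)⁻¹ = 1 / 2 := by
  rw [← mul_inv, ← Complex.ofReal_mul, Real.mul_self_sqrt (by norm_num)]
  norm_num

lemma star_sqrt_two : star ((Real.sqrt 2 : ℝ) : ℂ) = ((Real.sqrt 2 : ℝ) : ℂ) :=
  Complex.conj_ofReal _

/-- The gate `(σ_a + σ_b) / √2`, for anticommuting Pauli matrices `σ_a` and `σ_b`. -/
def pauliSwap {a b : Fin 4 × Fin 4} (h : Anticomm₂ a b) : TwoQubitGate :=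
  ⟨((Real.sqrt 2 : ℝ) : ℂ)⁻¹ • (pauli₂ a + pauli₂ b), by
    rw [Matrix.mem_unitaryGroup_iff, Matrix.star_eq_conjTranspose, Matrix.conjTranspose_smul,
      Matrix.conjTranspose_add, pauli₂_conjTranspose, pauli₂_conjTranspose, Matrix.smul_mul,
      Matrix.mul_smul, smul_smul, star_inv₀, star_sqrt_two, inv_sqrt_two_mul_self,
      mul_add, add_mul, add_mul, pauli₂_mul_self, pauli₂_mul_self, pauli₂_anticomm h]
    rw [show (1 : Matrix (Fin 2 × Fin 2) (Fin 2 × Fin 2) ℂ) + pauli₂ b * pauli₂ a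
      + (-(pauli₂ b * pauli₂ a) + 1) = (2 : ℂ) • 1 by rw [two_smul]; abel, smul_smul]
    norm_num⟩

lemma pauliSwap_conj {a b : Fin 4 × Fin 4} (h : Anticomm₂ a b) :
    star (pauliSwap h).1 * pauli₂ a * (pauliSwap h).1 = pauli₂ b := by
  simp only [pauliSwap, Matrix.star_eq_conjTranspose, Matrix.conjTranspose_smul,
    Matrix.conjTranspose_add, pauli₂_conjTranspose, star_inv₀]
  rw [star_sqrt_two, Matrix.smul_mul, Matrix.smul_mul, Matrix.mul_smul, smul_smul,
    inv_sqrt_two_mul_self]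
  have e : (pauli₂ a + pauli₂ b) * pauli₂ a * (pauli₂ a + pauli₂ b) = (2 : ℂ) • pauli₂ b := by
    have e1 : pauli₂ b * pauli₂ a * pauli₂ b = -pauli₂ a := by
      rw [← neg_eq_iff_eq_neg, ← Matrix.neg_mul, ← pauli₂_anticomm h, Matrix.mul_assoc,
        pauli₂_mul_self, Matrix.mul_one]
    rw [add_mul, pauli₂_mul_self, add_mul, mul_add, one_mul, mul_add, one_mul, e1,
      Matrix.mul_assoc, pauli₂_mul_self, mul_one, two_smul]
    abel
  rw [e, smul_smul]; norm_num

lemma integral_pauliTransfer_of_anticomm {a a' : Fin 4 × Fin 4} (h : Anticomm₂ a a')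
    (b c : Fin 4 × Fin 4) :
    ∫ u, pauliTransfer u a b * pauliTransfer u a c ∂haarGate
      = ∫ u, pauliTransfer u a' b * pauliTransfer u a' c ∂haarGate := by
  have key : ∀ u b, pauliTransfer (pauliSwap h * u) a b = pauliTransfer u a' b := by
    intro u b
    unfold pauliTransfer
    rw [← pauliSwap_conj h]
    simp only [Submonoid.coe_mul, star_mul, Matrix.mul_assoc]
  rw [← integral_mul_left_eq_self _ (pauliSwap h)]
  simp only [key]

/-- The squared matrix of the adjoint action of a Haar random gate, on average: the identity stays,
and a nontrivial Pauli matrix becomes each of the fifteen nontrivial ones with equal weight. -/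
def mixKernel (a b : Fin 4 × Fin 4) : ℝ :=
  if a = 0 then (if b = 0 then 1 else 0) else if b = 0 then 0 else 1 / 15

lemma pauliTransfer_zero_left (u : TwoQubitGate) (b : Fin 4 × Fin 4) :
    pauliTransfer u 0 b = if b = 0 then 1 else 0 := by
  have h := trace_pauli₂_mul b 0
  rw [pauli₂_zero, mul_one] at h
  rw [pauliTransfer, pauli₂_zero, mul_one, Matrix.mem_unitaryGroup_iff'.1 u.2, mul_one, h]
  split_ifs <;> norm_num

/-- The second moments of the adjoint action of a Haar random gate. Left invariance, applied to
`pauliSwap`, makes them equal for all nontrivial `a`; their sum over `a` is known. -/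
lemma integral_pauliTransfer_mul (a b c : Fin 4 × Fin 4) :
    ∫ u, pauliTransfer u a b * pauliTransfer u a c ∂haarGate
      = if b = c then (mixKernel a b : ℂ) else 0 := by
  by_cases ha : a = 0
  · subst ha
    simp only [pauliTransfer_zero_left, integral_const, mixKernel]
    by_cases hb : b = 0 <;> by_cases hbc : b = c <;> simp_all [eq_comm]
  have hall : ∀ a', a' ≠ 0 → ∫ u, pauliTransfer u a' b * pauliTransfer u a' c ∂haarGate
      = ∫ u, pauliTransfer u a b * pauliTransfer u a c ∂haarGate := by
    intro a' ha'
    obtain ⟨e, h1, h2⟩ := exists_anticomm₂ a' a ha' ha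
    rw [integral_pauliTransfer_of_anticomm h1, integral_pauliTransfer_of_anticomm h2]
  have hsum : ∑ a', ∫ u, pauliTransfer u a' b * pauliTransfer u a' c ∂haarGate
      = if b = c then 1 else 0 := by
    rw [← integral_finsetSum]
    · simp only [sum_pauliTransfer_mul, integral_const]
      simp
    · intro i _
      exact integrable_haarGate_of_continuous
        ((continuous_pauliTransfer i b).mul (continuous_pauliTransfer i c))
  -- The row of the identity contributes `δ_b0 δ_c0`, and the other fifteen rows agree.
  rw [← Finset.add_sum_erase _ _ (Finset.mem_univ 0),
    Finset.sum_congr rfl fun x hx => hall x (Finset.ne_of_mem_erase hx), Finset.sum_const,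
    Finset.card_erase_of_mem (Finset.mem_univ _)] at hsum
  simp only [pauliTransfer_zero_left, integral_const] at hsum
  simp only [mixKernel, ha, if_false]
  generalize ∫ u, pauliTransfer u a b * pauliTransfer u a c ∂haarGate = I at hsum ⊢
  have hI : 15 * I = (if b = c then 1 else 0) -
      (if b = 0 then 1 else 0) * (if c = 0 then 1 else 0) := by
    rw [← hsum]; simp
  by_cases hb : b = 0 <;> by_cases hbc : b = c
  · subst hbc; simpa [hb] using hI
  · subst hb; simp_all [eq_comm]
  · subst hbc; simp only [hb, if_true, if_false] at hI ⊢; push_cast; linear_combination hI / 15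
  · simpa [hb, hbc] using hI

/-! ### Pauli strings and layers of gates -/

/-- Pauli strings on `n` qubits; letter `0` is the identity. -/
abbrev PauliString (n : ℕ) : Type := Fin n → Fin 4

/-- The tensor product of the Pauli matrices of a Pauli string. -/
def pauliMatrix {n : ℕ} (P : PauliString n) : QMatrix n :=
  Matrix.of fun s t => ∏ i, pauli (P i) (s i) (t i)

/-- The coefficient of a Pauli string in the expansion of an operator, up to the factor `2⁻ⁿ`. -/
def pauliCoeff {n : ℕ} (P : PauliString n) (ρ : QMatrix n) : ℂ :=
  (pauliMatrix P * ρ).trace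

/-- Configurations of `n` sites, seen as configurations of the pairs of a layer. -/
def pairEquiv {n : ℕ} (e : Fin (n / 2) × Fin 2 ≃ Fin n) (α : Type*) :
    (Fin n → α) ≃ (Fin (n / 2) → α × α) :=
  (e.symm.arrowCongr (Equiv.refl α)).trans
    ((Equiv.curry _ _ _).trans ((Equiv.refl _).arrowCongr (finTwoArrowEquiv α)))

@[simp] lemma pairEquiv_apply {n : ℕ} (e : Fin (n / 2) × Fin 2 ≃ Fin n) {α : Type*}
    (x : Fin n → α) (g : Fin (n / 2)) : pairEquiv e α x g = (x (e (g, 0)), x (e (g, 1))) := rfl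

lemma prod_eq_prod_pairs {n : ℕ} (e : Fin (n / 2) × Fin 2 ≃ Fin n) {M : Type*} [CommMonoid M]
    (f : Fin n → M) : ∏ i, f i = ∏ g, f (e (g, 0)) * f (e (g, 1)) := by
  rw [← e.prod_comp, Fintype.prod_prod_type]
  simp only [Fin.prod_univ_two]

/-- The sum over all configurations of a product over the pairs is a product of sums. -/
lemma sum_prod_pairs {n : ℕ} (e : Fin (n / 2) × Fin 2 ≃ Fin n) {α R : Type*} [Fintype α]
    [DecidableEq α] [CommSemiring R] (f : Fin (n / 2) → α × α → R) :
    ∑ x : Fin n → α, ∏ g, f g (pairEquiv e α x g) = ∏ g, ∑ a, f g a := by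
  rw [(pairEquiv e α).sum_comp fun y => ∏ g, f g (y g), Finset.prod_univ_sum,
    Fintype.piFinset_univ]

/-- The tensor product of operators on the pairs of a layer. -/
def pairTensor {n : ℕ} (e : Fin (n / 2) × Fin 2 ≃ Fin n)
    (M : Fin (n / 2) → Matrix (Fin 2 × Fin 2) (Fin 2 × Fin 2) ℂ) : QMatrix n :=
  Matrix.of fun s t => ∏ g, M g (pairEquiv e _ s g) (pairEquiv e _ t g)

lemma pairTensor_mul {n : ℕ} (e : Fin (n / 2) × Fin 2 ≃ Fin n)
    (M N : Fin (n / 2) → Matrix (Fin 2 × Fin 2) (Fin 2 × Fin 2) ℂ) :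
    pairTensor e M * pairTensor e N = pairTensor e fun g => M g * N g := by
  ext s t
  simp only [pairTensor, Matrix.mul_apply, Matrix.of_apply, ← Finset.prod_mul_distrib]
  exact sum_prod_pairs e fun g r => M g (pairEquiv e _ s g) r * N g r (pairEquiv e _ t g)

lemma pairTensor_conjTranspose {n : ℕ} (e : Fin (n / 2) × Fin 2 ≃ Fin n)
    (M : Fin (n / 2) → Matrix (Fin 2 × Fin 2) (Fin 2 × Fin 2) ℂ) :
    (pairTensor e M).conjTranspose = pairTensor e fun g => star (M g) := by
  ext s t
  simp [pairTensor, Matrix.conjTranspose_apply, Matrix.star_apply]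

lemma layerUnitary_eq_pairTensor {n : ℕ} (e : Fin (n / 2) × Fin 2 ≃ Fin n)
    (u : Fin (n / 2) → TwoQubitGate) : layerUnitary e u = pairTensor e fun g => (u g).1 := rfl

lemma pauliMatrix_eq_pairTensor {n : ℕ} (e : Fin (n / 2) × Fin 2 ≃ Fin n) (P : PauliString n) :
    pauliMatrix P = pairTensor e fun g => pauli₂ (pairEquiv e _ P g) := by
  ext s t
  simp only [pauliMatrix, pairTensor, Matrix.of_apply]
  rw [prod_eq_prod_pairs e]
  rfl

lemma layerUnitary_conj_pauliMatrix {n : ℕ} (e : Fin (n / 2) × Fin 2 ≃ Fin n)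
    (u : Fin (n / 2) → TwoQubitGate) (P : PauliString n) :
    (layerUnitary e u).conjTranspose * pauliMatrix P * layerUnitary e u
      = ∑ P' : PauliString n,
        (∏ g, pauliTransfer (u g) (pairEquiv e _ P g) (pairEquiv e _ P' g)) • pauliMatrix P' := by
  rw [layerUnitary_eq_pairTensor, pauliMatrix_eq_pairTensor e, pairTensor_conjTranspose,
    pairTensor_mul, pairTensor_mul]
  ext s t
  simp only [conj_pauli₂, Matrix.sum_apply, Matrix.smul_apply, smul_eq_mul,
    pauliMatrix_eq_pairTensor e]
  simp only [pairTensor, Matrix.of_apply, Matrix.sum_apply, Matrix.smul_apply, smul_eq_mul,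
    ← Finset.prod_mul_distrib]
  exact (sum_prod_pairs e fun g b => pauliTransfer (u g) (pairEquiv e _ P g) b *
    pauli₂ b (pairEquiv e _ s g) (pairEquiv e _ t g)).symm

lemma pauliCoeff_layerUnitary_conj {n : ℕ} (e : Fin (n / 2) × Fin 2 ≃ Fin n)
    (u : Fin (n / 2) → TwoQubitGate) (P : PauliString n) (ρ : QMatrix n) :
    pauliCoeff P (layerUnitary e u * ρ * (layerUnitary e u).conjTranspose)
      = ∑ P' : PauliString n,
        (∏ g, pauliTransfer (u g) (pairEquiv e _ P g) (pairEquiv e _ P' g)) * pauliCoeff P' ρ := by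
  have h : pauliCoeff P (layerUnitary e u * ρ * (layerUnitary e u).conjTranspose)
      = ((layerUnitary e u).conjTranspose * pauliMatrix P * layerUnitary e u * ρ).trace := by
    rw [pauliCoeff, ← Matrix.mul_assoc, Matrix.trace_mul_comm]
    simp only [Matrix.mul_assoc]
  rw [h, layerUnitary_conj_pauliMatrix, Matrix.sum_mul, Matrix.trace_sum]
  simp only [Matrix.smul_mul, Matrix.trace_smul, smul_eq_mul, pauliCoeff]

/-- The average action of a layer of Haar random gates on the squared coefficients of Pauli
strings. -/
def mixMatrix {n : ℕ} (e : Fin (n / 2) × Fin 2 ≃ Fin n) :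
    Matrix (PauliString n) (PauliString n) ℝ :=
  Matrix.of fun P P' => ∏ g, mixKernel (pairEquiv e _ P g) (pairEquiv e _ P' g)

/-- The mean squared coefficients after a layer of Haar random gates. The gates of a layer are
independent, so the second moments of the layer factorize over the pairs. -/
lemma integral_normSq_pauliCoeff_layer {n : ℕ} (e : Fin (n / 2) × Fin 2 ≃ Fin n)
    (P : PauliString n) (ρ : QMatrix n) :
    ∫ u, Complex.normSq
        (pauliCoeff P (layerUnitary e u * ρ * (layerUnitary e u).conjTranspose))
        ∂(Measure.pi fun _ : Fin (n / 2) => haarGate)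
      = (mixMatrix e).mulVec (fun P' => Complex.normSq (pauliCoeff P' ρ)) P := by
  -- The square expands to a double sum of products of complex second moments.
  rw [← Complex.ofReal_inj, ← integral_complex_ofReal]
  have hint : ∀ P' P'' : PauliString n, Integrable (fun u : Fin (n / 2) → TwoQubitGate =>
      ∏ g, pauliTransfer (u g) (pairEquiv e _ P g) (pairEquiv e _ P' g) *
        pauliTransfer (u g) (pairEquiv e _ P g) (pairEquiv e _ P'' g))
      (Measure.pi fun _ => haarGate) := fun P' P'' =>
    Integrable.fintype_prod fun g => integrable_haarGate_of_continuous
      ((continuous_pauliTransfer _ _).mul (continuous_pauliTransfer _ _))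
  have hexp : ∀ u : Fin (n / 2) → TwoQubitGate,
      ((Complex.normSq (pauliCoeff P
        (layerUnitary e u * ρ * (layerUnitary e u).conjTranspose)) : ℝ) : ℂ)
      = ∑ P' : PauliString n, ∑ P'' : PauliString n,
        (∏ g, pauliTransfer (u g) (pairEquiv e _ P g) (pairEquiv e _ P' g) *
        pauliTransfer (u g) (pairEquiv e _ P g) (pairEquiv e _ P'' g)) *
        (pauliCoeff P' ρ * star (pauliCoeff P'' ρ)) := by
    intro u
    rw [← Complex.mul_conj, starRingEnd_apply, pauliCoeff_layerUnitary_conj, star_sum,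
      Finset.sum_mul_sum]
    refine Finset.sum_congr rfl fun P' _ => Finset.sum_congr rfl fun P'' _ => ?_
    rw [star_mul', star_prod, Finset.prod_mul_distrib]
    simp only [star_pauliTransfer]
    ring
  simp only [hexp]
  rw [integral_finsetSum _ fun P' _ => integrable_finsetSum _ fun P'' _ =>
    (hint P' P'').mul_const _, Matrix.mulVec, dotProduct,
    Complex.ofReal_sum]
  refine Finset.sum_congr rfl fun P' _ => ?_
  rw [integral_finsetSum _ fun P'' _ => (hint P' P'').mul_const _]
  simp only [integral_mul_const]
  have hprod : ∀ P'' : PauliString n, ∫ u : Fin (n / 2) → TwoQubitGate,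
      ∏ g, pauliTransfer (u g) (pairEquiv e _ P g) (pairEquiv e _ P' g) *
        pauliTransfer (u g) (pairEquiv e _ P g) (pairEquiv e _ P'' g)
      ∂(Measure.pi fun _ => haarGate)
      = if P' = P'' then
        ∏ g, (mixKernel (pairEquiv e _ P g) (pairEquiv e _ P' g) : ℂ) else 0 := by
    intro P''
    rw [integral_fintype_prod_eq_prod (fun g v => pauliTransfer v (pairEquiv e _ P g)
      (pairEquiv e _ P' g) * pauliTransfer v (pairEquiv e _ P g) (pairEquiv e _ P'' g))]
    simp only [integral_pauliTransfer_mul]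
    by_cases h : P' = P''
    · subst h; simp
    · rw [if_neg h]
      obtain ⟨g, hg⟩ : ∃ g, pairEquiv e _ P' g ≠ pairEquiv e _ P'' g := by
        by_contra! hc
        exact h ((pairEquiv e _).injective (funext hc))
      exact Finset.prod_eq_zero (Finset.mem_univ g) (if_neg hg)
  simp only [hprod]
  rw [Finset.sum_eq_single P']
  · rw [if_pos rfl, ← starRingEnd_apply, Complex.mul_conj]
    simp only [mixMatrix, Matrix.of_apply]
    push_cast
    rfl
  · intro b _ hb; simp [Ne.symm hb]
  · simp

/-! ### Dephasing noise -/

/-- The factor by which dephasing with strength `q` multiplies a Pauli matrix. -/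
def dephaseFactor (q : ℝ) (a : Fin 4) : ℝ := if a = 1 ∨ a = 2 then 1 - 2 * q else 1

lemma pauliZ_conj_pauliMatrix {n : ℕ} (i : Fin n) (P : PauliString n) :
    pauliZ i * pauliMatrix P * pauliZ i
      = (if P i = 1 ∨ P i = 2 then (-1 : ℂ) else 1) • pauliMatrix P := by
  have hsite : ∀ (a : Fin 4) (s t : Fin 2),
      (if s = 0 then (1 : ℂ) else -1) * pauli a s t * (if t = 0 then 1 else -1)
        = (if a = 1 ∨ a = 2 then -1 else 1) * pauli a s t := by
    intro a s t
    fin_cases a <;> fin_cases s <;> fin_cases t <;> simp [pauli]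
  ext s t
  rw [pauliZ, Matrix.mul_diagonal, Matrix.diagonal_mul]
  simp only [pauliMatrix, Matrix.of_apply, Matrix.smul_apply, smul_eq_mul]
  rw [← Finset.mul_prod_erase _ _ (Finset.mem_univ i), ← mul_assoc, ← mul_assoc, ← hsite]
  ring

lemma pauliCoeff_dephase {n : ℕ} (q : ℝ) (i : Fin n) (P : PauliString n) (ρ : QMatrix n) :
    pauliCoeff P (dephase q i ρ) = dephaseFactor q (P i) * pauliCoeff P ρ := by
  have h : (pauliMatrix P * (pauliZ i * ρ * pauliZ i)).trace
      = (pauliZ i * pauliMatrix P * pauliZ i * ρ).trace := by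
    rw [← Matrix.mul_assoc, Matrix.trace_mul_comm]
    simp only [Matrix.mul_assoc]
  rw [pauliCoeff, dephase, Matrix.mul_add, Matrix.trace_add, Matrix.mul_smul, Matrix.mul_smul,
    Matrix.trace_smul, Matrix.trace_smul, h, pauliZ_conj_pauliMatrix, Matrix.smul_mul,
    Matrix.trace_smul, dephaseFactor, pauliCoeff]
  simp only [smul_eq_mul]
  split_ifs <;> push_cast <;> ring

lemma pauliCoeff_noiseLayer {n : ℕ} (q : ℝ) (L : Fin n → Bool) (P : PauliString n)
    (ρ : QMatrix n) :
    pauliCoeff P (noiseLayer q L ρ)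
      = ((∏ i, if L i then dephaseFactor q (P i) else 1 : ℝ) : ℂ) * pauliCoeff P ρ := by
  have h : ∀ (l : List (Fin n)) (ρ : QMatrix n),
      pauliCoeff P (l.foldl (fun σ i => if L i then dephase q i σ else σ) ρ)
        = (((l.map fun i => if L i then dephaseFactor q (P i) else 1).prod : ℝ) : ℂ)
          * pauliCoeff P ρ := by
    intro l
    induction l with
    | nil => simp
    | cons i l ih =>
      intro ρ
      rw [List.foldl_cons, ih, List.map_cons, List.prod_cons]
      split_ifs
      · rw [pauliCoeff_dephase]; push_cast; ring
      · simp
  rw [noiseLayer, h, ← Fin.prod_univ_def]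

/-! ### Running a circuit -/

/-- The state after a layer of gates and noise. -/
def layerStep {n : ℕ} (e : Fin (n / 2) × Fin 2 ≃ Fin n) (q : ℝ)
    (u : Fin (n / 2) → TwoQubitGate) (L : Fin n → Bool) (ρ : QMatrix n) : QMatrix n :=
  noiseLayer q L (layerUnitary e u * ρ * (layerUnitary e u).conjTranspose)

/-- The output state of a noisy circuit applied to an arbitrary input operator. -/
def circuitRun {n d : ℕ} (e : Fin d → (Fin (n / 2) × Fin 2 ≃ Fin n)) (q : ℝ) (u : Gates n d)
    (L : Locations n d) (ρ : QMatrix n) : QMatrix n :=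
  (List.finRange d).foldl (fun ρ m => layerStep (e m) q (u m) (L m) ρ) ρ

lemma outputState_eq_circuitRun {n d : ℕ} (A : ParallelArchitecture n d) (q : ℝ) (u : Gates n d)
    (L : Locations n d) : outputState A q u L = circuitRun A.site q u L (zeroState n) := rfl

lemma circuitRun_zero {n : ℕ} (e : Fin 0 → (Fin (n / 2) × Fin 2 ≃ Fin n)) (q : ℝ)
    (u : Gates n 0) (L : Locations n 0) (ρ : QMatrix n) : circuitRun e q u L ρ = ρ := rfl

lemma circuitRun_succ {n d : ℕ} (e : Fin (d + 1) → (Fin (n / 2) × Fin 2 ≃ Fin n)) (q : ℝ)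
    (u : Gates n (d + 1)) (L : Locations n (d + 1)) (ρ : QMatrix n) :
    circuitRun e q u L ρ
      = circuitRun (fun m => e m.succ) q (fun m => u m.succ) (fun m => L m.succ)
        (layerStep (e 0) q (u 0) (L 0) ρ) := by
  rw [circuitRun, List.finRange_succ, List.foldl_cons, List.foldl_map]
  rfl

lemma continuous_layerUnitary {n : ℕ} (e : Fin (n / 2) × Fin 2 ≃ Fin n) :
    Continuous (layerUnitary e) := by
  refine continuous_matrix fun x y => ?_
  simp only [layerUnitary, Matrix.of_apply]
  refine continuous_finsetProd _ fun g _ => ?_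
  have h : Continuous fun u : Fin (n / 2) → TwoQubitGate => (u g).1 :=
    continuous_subtype_val.comp (continuous_apply g)
  exact h.matrix_elem _ _

lemma continuous_noiseLayer {n : ℕ} (q : ℝ) (L : Fin n → Bool) :
    Continuous (noiseLayer q L : QMatrix n → QMatrix n) := by
  have h : ∀ l : List (Fin n), Continuous fun ρ : QMatrix n =>
      l.foldl (fun σ i => if L i then dephase q i σ else σ) ρ := by
    intro l
    induction l with
    | nil => exact continuous_id
    | cons i l ih =>
      simp only [List.foldl_cons]
      by_cases hL : L i
      · simp only [hL, if_true]
        have hd : Continuous (dephase q i : QMatrix n → QMatrix n) := by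
          have h1 : Continuous fun ρ : QMatrix n => pauliZ i * ρ * pauliZ i :=
            (continuous_const.matrix_mul continuous_id).matrix_mul continuous_const
          exact (continuous_id.const_smul ((1 - q : ℝ) : ℂ)).add (h1.const_smul (q : ℂ))
        exact Continuous.comp ih hd
      · simpa only [hL, Bool.false_eq_true, if_false] using ih
  exact h _

lemma continuous_layerStep {n : ℕ} (e : Fin (n / 2) × Fin 2 ≃ Fin n) (q : ℝ)
    (L : Fin n → Bool) :
    Continuous fun x : (Fin (n / 2) → TwoQubitGate) × QMatrix n => layerStep e q x.1 L x.2 := by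
  have h := (continuous_layerUnitary e).comp
    (continuous_fst (X := Fin (n / 2) → TwoQubitGate) (Y := QMatrix n))
  exact (continuous_noiseLayer q L).comp
    ((h.matrix_mul continuous_snd).matrix_mul h.matrix_conjTranspose)

lemma continuous_circuitRun {n : ℕ} (q : ℝ) : ∀ {d : ℕ}
    (e : Fin d → (Fin (n / 2) × Fin 2 ≃ Fin n)) (L : Locations n d),
    Continuous fun x : Gates n d × QMatrix n => circuitRun e q x.1 L x.2 := by
  intro d
  induction d with
  | zero => intro e L; exact continuous_snd
  | succ d ih =>
    intro e L
    simp only [circuitRun_succ]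
    refine (ih (fun m => e m.succ) (fun m => L m.succ)).comp
      (f := fun x : Gates n (d + 1) × QMatrix n =>
        ((fun m => x.1 m.succ : Gates n d), layerStep (e 0) q (x.1 0) (L 0) x.2)) ?_
    refine Continuous.prodMk (by fun_prop) ?_
    exact (continuous_layerStep (e 0) q (L 0)).comp
      (f := fun x : Gates n (d + 1) × QMatrix n => (x.1 0, x.2)) (by fun_prop)

lemma continuous_pauliCoeff {n : ℕ} (P : PauliString n) : Continuous (pauliCoeff P) := by
  unfold pauliCoeff
  fun_prop

/-! ### The second moment of a random circuit -/

/-- Fubini's theorem for the first factor of a finite power of a probability space. -/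
lemma integral_pi_fin_succ {X : Type*} [MeasurableSpace X] (μ : Measure X)
    [IsProbabilityMeasure μ] {d : ℕ} (f : X → (Fin d → X) → ℝ)
    (hf : Integrable (Function.uncurry f) (μ.prod (Measure.pi fun _ => μ))) :
    ∫ u : Fin (d + 1) → X, f (u 0) (fun j => u j.succ) ∂(Measure.pi fun _ => μ)
      = ∫ x, ∫ y, f x y ∂(Measure.pi fun _ => μ) ∂μ := by
  have h := (measurePreserving_piFinSuccAbove (fun _ : Fin (d + 1) => μ) 0).integral_comp'
    (Function.uncurry f)
  rw [integral_prod _ hf] at h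
  exact h

/-- The action of a circuit with noise locations `L` on the squared coefficients of Pauli strings,
averaged over the gates. The first layer is the rightmost factor. -/
def transferMatrix {n : ℕ} (q : ℝ) : ∀ {d : ℕ} (_ : Fin d → (Fin (n / 2) × Fin 2 ≃ Fin n))
    (_ : Locations n d), Matrix (PauliString n) (PauliString n) ℝ
  | 0, _, _ => 1
  | _ + 1, e, L => transferMatrix q (fun m => e m.succ) (fun m => L m.succ) *
      (Matrix.diagonal (fun P => ∏ i, if L 0 i then dephaseFactor q (P i) ^ 2 else 1) *
        mixMatrix (e 0))

lemma normSq_pauliCoeff_layerStep {n : ℕ} (e : Fin (n / 2) × Fin 2 ≃ Fin n) (q : ℝ)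
    (u : Fin (n / 2) → TwoQubitGate) (L : Fin n → Bool) (ρ : QMatrix n) (P : PauliString n) :
    Complex.normSq (pauliCoeff P (layerStep e q u L ρ))
      = (∏ i, if L i then dephaseFactor q (P i) ^ 2 else 1) * Complex.normSq
        (pauliCoeff P (layerUnitary e u * ρ * (layerUnitary e u).conjTranspose)) := by
  rw [layerStep, pauliCoeff_noiseLayer, Complex.normSq_mul, Complex.normSq_ofReal,
    ← Finset.prod_mul_distrib]
  congr 1
  refine Finset.prod_congr rfl fun i _ => ?_
  split_ifs <;> ring

lemma integral_normSq_pauliCoeff_circuitRun {n : ℕ} (q : ℝ) : ∀ {d : ℕ}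
    (e : Fin d → (Fin (n / 2) × Fin 2 ≃ Fin n)) (L : Locations n d) (P : PauliString n)
    (ρ : QMatrix n),
    ∫ u, Complex.normSq (pauliCoeff P (circuitRun e q u L ρ)) ∂(gateLaw n d)
      = (transferMatrix q e L).mulVec (fun P' => Complex.normSq (pauliCoeff P' ρ)) P := by
  intro d
  induction d with
  | zero =>
    intro e L P ρ
    simp only [circuitRun_zero, transferMatrix, Matrix.one_mulVec, integral_const]
    simp
  | succ d ih =>
    intro e L P ρ
    simp only [circuitRun_succ]
    rw [gateLaw, integral_pi_fin_succ (Measure.pi fun _ : Fin (n / 2) => haarGate)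
      (fun u₀ u => Complex.normSq (pauliCoeff P (circuitRun (fun m => e m.succ) q u
        (fun m => L m.succ) (layerStep (e 0) q u₀ (L 0) ρ))))]
    · have hin : ∀ u₀, ∫ u, Complex.normSq (pauliCoeff P (circuitRun (fun m => e m.succ) q u
          (fun m => L m.succ) (layerStep (e 0) q u₀ (L 0) ρ)))
          ∂(Measure.pi fun _ : Fin d => Measure.pi fun _ : Fin (n / 2) => haarGate)
          = ∑ P', transferMatrix q (fun m => e m.succ) (fun m => L m.succ) P P' *
            ((∏ i, if L 0 i then dephaseFactor q (P' i) ^ 2 else 1) * Complex.normSq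
        (pauliCoeff P' (layerUnitary (e 0) u₀ * ρ * (layerUnitary (e 0) u₀).conjTranspose))) := by
        intro u₀
        rw [← gateLaw, ih]
        simp only [Matrix.mulVec, dotProduct, normSq_pauliCoeff_layerStep]
      simp only [hin]
      rw [integral_finsetSum]
      · simp only [integral_const_mul, integral_normSq_pauliCoeff_layer]
        rw [transferMatrix, ← Matrix.mulVec_mulVec, ← Matrix.mulVec_mulVec]
        conv_rhs => rw [Matrix.mulVec, dotProduct]
        simp only [Matrix.mulVec_diagonal]
      · intro P' _
        refine Integrable.const_mul (Integrable.const_mul ?_ _) _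
        have hU := continuous_layerUnitary (e 0)
        exact Continuous.integrable_of_hasCompactSupport
          (Complex.continuous_normSq.comp ((continuous_pauliCoeff P').comp
            ((hU.matrix_mul continuous_const).matrix_mul hU.matrix_conjTranspose)))
          (HasCompactSupport.of_compactSpace _)
    · refine Continuous.integrable_of_hasCompactSupport ?_ (HasCompactSupport.of_compactSpace _)
      refine Complex.continuous_normSq.comp ((continuous_pauliCoeff P).comp ?_)
      refine (continuous_circuitRun q (fun m => e m.succ) (fun m => L m.succ)).comp
        (f := fun x : (Fin (n / 2) → TwoQubitGate) × Gates n d =>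
          (x.2, layerStep (e 0) q x.1 (L 0) ρ)) ?_
      refine Continuous.prodMk continuous_snd ?_
      exact (continuous_layerStep (e 0) q (L 0)).comp
        (f := fun x : (Fin (n / 2) → TwoQubitGate) × Gates n d => (x.1, ρ)) (by fun_prop)

/-- The average factor by which heralded dephasing multiplies the squared coefficient of a Pauli
matrix, in terms of the rate `y = 8 q (1 - q) p / 3`: indeed
`(1 - p) + p (1 - 2 q)² = 1 - 3 y / 2`. -/
def siteWeight (y : ℝ) (a : Fin 4) : ℝ := if a = 1 ∨ a = 2 then 1 - 3 / 2 * y else 1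

/-- The action of a circuit on the squared coefficients of Pauli strings, averaged over the gates
and the noise locations. -/
def meanTransferMatrix {n : ℕ} (y : ℝ) : ∀ {d : ℕ}
    (_ : Fin d → (Fin (n / 2) × Fin 2 ≃ Fin n)), Matrix (PauliString n) (PauliString n) ℝ
  | 0, _ => 1
  | _ + 1, e => meanTransferMatrix y (fun m => e m.succ) *
      (Matrix.diagonal (fun P => ∏ i, siteWeight y (P i)) * mixMatrix (e 0))

lemma integral_noiseFactor {n : ℕ} (p : unitInterval) (q : ℝ) (P : PauliString n) :
    ∫ L : Fin n → Bool, (∏ i, if L i then dephaseFactor q (P i) ^ 2 else 1)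
      ∂(Measure.pi fun _ => bernoulliMeasure true false p)
      = ∏ i, siteWeight (8 * q * (1 - q) / 3 * p) (P i) := by
  rw [integral_fintype_prod_eq_prod (fun i (b : Bool) =>
    if b then dephaseFactor q (P i) ^ 2 else 1)]
  refine Finset.prod_congr rfl fun i _ => ?_
  rw [integral_bernoulliMeasure]
  simp only [dephaseFactor, siteWeight, if_true, smul_eq_mul, Bool.false_eq_true, if_false]
  split_ifs <;> ring

lemma integral_transferMatrix {n : ℕ} (p : unitInterval) (q : ℝ) : ∀ {d : ℕ}
    (e : Fin d → (Fin (n / 2) × Fin 2 ≃ Fin n)) (P P' : PauliString n),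
    ∫ L, transferMatrix q e L P P' ∂(locationLaw n d p)
      = meanTransferMatrix (8 * q * (1 - q) / 3 * p) e P P' := by
  intro d
  induction d with
  | zero =>
    intro e P P'
    simp only [transferMatrix, meanTransferMatrix, integral_const, probReal_univ, one_smul]
  | succ d ih =>
    intro e P P'
    simp only [transferMatrix, meanTransferMatrix]
    rw [locationLaw, integral_pi_fin_succ
      (Measure.pi fun _ : Fin n => bernoulliMeasure true false p)
      (fun L₀ L => (transferMatrix q (fun m => e m.succ) L * (Matrix.diagonal
        (fun P : PauliString n => ∏ i, if L₀ i then dephaseFactor q (P i) ^ 2 else 1) *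
          mixMatrix (e 0))) P P')
      Integrable.of_finite]
    simp only [Matrix.mul_apply (M := transferMatrix _ _ _),
      Matrix.mul_apply (M := meanTransferMatrix _ _), Matrix.diagonal_mul]
    have hin : ∀ L₀ : Fin n → Bool, ∫ L, ∑ P'', transferMatrix q (fun m => e m.succ) L P P'' *
        ((∏ i, if L₀ i then dephaseFactor q (P'' i) ^ 2 else 1) * mixMatrix (e 0) P'' P')
        ∂(Measure.pi fun _ : Fin d => Measure.pi fun _ : Fin n => bernoulliMeasure true false p)
        = ∑ P'', meanTransferMatrix (8 * q * (1 - q) / 3 * p) (fun m => e m.succ) P P'' *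
          ((∏ i, if L₀ i then dephaseFactor q (P'' i) ^ 2 else 1) * mixMatrix (e 0) P'' P') := by
      intro L₀
      rw [integral_finsetSum _ fun _ _ => Integrable.of_finite]
      simp only [integral_mul_const]
      simp only [← locationLaw.eq_1, ih]
    simp only [hin]
    rw [integral_finsetSum _ fun _ _ => Integrable.of_finite]
    simp only [integral_const_mul, integral_mul_const, integral_noiseFactor]

/-! ### Contraction of the second moment -/

/-- The indicator of the Pauli strings made of `1` and `Z`, which are the diagonal ones. -/
def zIndicator {n : ℕ} (P : PauliString n) : ℝ := ∏ i, if P i = 0 ∨ P i = 3 then 1 else 0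

/-- The indicator of the Pauli strings supported in `T`. -/
def supportIndicator {n : ℕ} (T : Finset (Fin n)) (P : PauliString n) : ℝ :=
  ∏ i, if i ∈ T then 1 else if P i = 0 then 1 else 0

/-- The indicator of the Pauli strings supported in `T`, after an average layer of noise. -/
def noisySupport {n : ℕ} (y : ℝ) (T : Finset (Fin n)) (P : PauliString n) : ℝ :=
  (∏ i, siteWeight y (P i)) * supportIndicator T P

/-- The sites of the pairs in `G`. -/
def sitesOf {n : ℕ} (e : Fin (n / 2) × Fin 2 ≃ Fin n) (G : Finset (Fin (n / 2))) :
    Finset (Fin n) := {i | (e.symm i).1 ∈ G}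

/-- The total `siteWeight` of the Pauli matrices that a string supported in `T` may have at `i`. -/
def siteTotal {n : ℕ} (y : ℝ) (T : Finset (Fin n)) (i : Fin n) : ℝ :=
  if i ∈ T then 4 - 3 * y else 1

/-- The weight that noise and then a random gate give to each nontrivial Pauli matrix on the pair
`g`, starting from the indicator of the strings supported in `T`. In the mixture of indicators that
results, it is the probability that `g` belongs to the new support. -/
def spreadProb {n : ℕ} (e : Fin (n / 2) × Fin 2 ≃ Fin n) (y : ℝ) (T : Finset (Fin n))
    (g : Fin (n / 2)) : ℝ :=
  (siteTotal y T (e (g, 0)) * siteTotal y T (e (g, 1)) - 1) / 15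

lemma sum_mixKernel_mul (a : Fin 4 × Fin 4) (f : Fin 4 × Fin 4 → ℝ) :
    ∑ b, mixKernel a b * f b = if a = 0 then f 0 else (∑ b, f b - f 0) / 15 := by
  have h : ∑ b, f b = f 0 + ∑ b ∈ Finset.univ.erase 0, f b :=
    (Finset.add_sum_erase _ _ (Finset.mem_univ 0)).symm
  by_cases ha : a = 0
  · subst ha; simp [mixKernel]
  · rw [← Finset.add_sum_erase _ _ (Finset.mem_univ 0), h, if_neg ha,
      Finset.sum_congr rfl (g := fun b => 1 / 15 * f b) fun b hb => by
        simp [mixKernel, ha, Finset.ne_of_mem_erase hb], ← Finset.mul_sum]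
    simp only [mixKernel, ha, if_false, if_true]
    ring

lemma sum_siteWeight {n : ℕ} (y : ℝ) (T : Finset (Fin n)) (i : Fin n) :
    ∑ a, siteWeight y a * (if i ∈ T then 1 else if a = 0 then 1 else 0) = siteTotal y T i := by
  by_cases h : i ∈ T <;> simp [siteWeight, siteTotal, Fin.sum_univ_four, h]
  ring

lemma prod_sitesOf {n : ℕ} (e : Fin (n / 2) × Fin 2 ≃ Fin n) (G : Finset (Fin (n / 2)))
    (f h : Fin n → ℝ) :
    ∏ i, (if i ∈ sitesOf e G then f i else h i)
      = (∏ g ∈ G, f (e (g, 0)) * f (e (g, 1))) *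
        ∏ g ∈ Finset.univ \ G, h (e (g, 0)) * h (e (g, 1)) := by
  rw [prod_eq_prod_pairs e, ← Finset.prod_sdiff (Finset.subset_univ G), mul_comm]
  congr 1
  · refine Finset.prod_congr rfl fun g hg => ?_
    simp [sitesOf, hg]
  · refine Finset.prod_congr rfl fun g hg => ?_
    simp [sitesOf, (Finset.mem_sdiff.1 hg).2]

/-- Noise and then a layer of random gates turn the indicator of the strings supported in `T` into a
mixture of indicators: each pair `g` joins the support with probability `spreadProb e y T g`,
independently. -/
lemma mixMatrix_mulVec_noisySupport {n : ℕ} (e : Fin (n / 2) × Fin 2 ≃ Fin n) (y : ℝ)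
    (T : Finset (Fin n)) :
    (mixMatrix e).mulVec (noisySupport y T)
      = ∑ G : Finset (Fin (n / 2)), ((∏ g ∈ G, spreadProb e y T g) *
        ∏ g ∈ Finset.univ \ G, (1 - spreadProb e y T g)) • supportIndicator (sitesOf e G) := by
  ext P
  have h1 : (mixMatrix e).mulVec (noisySupport y T) P
      = ∏ g, (spreadProb e y T g + (1 - spreadProb e y T g) *
          ((if P (e (g, 0)) = 0 then 1 else 0) * (if P (e (g, 1)) = 0 then 1 else 0))) := by
    simp only [Matrix.mulVec, dotProduct, mixMatrix, Matrix.of_apply, noisySupport,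
      supportIndicator, ← Finset.prod_mul_distrib]
    simp only [prod_eq_prod_pairs e (fun i => siteWeight _ _ * _), ← Finset.prod_mul_distrib]
    refine (sum_prod_pairs e fun g b => mixKernel (pairEquiv e _ P g) b *
      (siteWeight y b.1 * (if e (g, 0) ∈ T then 1 else if b.1 = 0 then 1 else 0) *
      (siteWeight y b.2 * (if e (g, 1) ∈ T then 1 else if b.2 = 0 then 1 else 0)))).trans ?_
    refine Finset.prod_congr rfl fun g _ => ?_
    have hs : ∑ b : Fin 4 × Fin 4,
        (siteWeight y b.1 * (if e (g, 0) ∈ T then 1 else if b.1 = 0 then 1 else 0) *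
        (siteWeight y b.2 * (if e (g, 1) ∈ T then 1 else if b.2 = 0 then 1 else 0)))
        = siteTotal y T (e (g, 0)) * siteTotal y T (e (g, 1)) := by
      rw [← sum_siteWeight, ← sum_siteWeight, Finset.sum_mul_sum, Fintype.sum_prod_type]
    rw [sum_mixKernel_mul, hs]
    simp only [spreadProb, pairEquiv_apply, Prod.mk_eq_zero, siteWeight]
    by_cases h0 : P (e (g, 0)) = 0 <;> by_cases h1 : P (e (g, 1)) = 0 <;> simp [h0, h1]
  -- Expanding the product over the pairs yields one term for each set of pairs that spread.
  rw [h1, Finset.prod_add, Finset.powerset_univ, Finset.sum_apply]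
  refine Finset.sum_congr rfl fun G _ => ?_
  rw [Pi.smul_apply, smul_eq_mul, supportIndicator, prod_sitesOf, Finset.prod_mul_distrib]
  simp [mul_assoc]

/-- The inequality behind the contraction: if `c` is the spread probability of a pair, then
`1 + c ((1 + b)² - 1)` is at most `1 + (1 - y) b` to the number of the sites of `T` in the pair. -/
lemma spread_le {n : ℕ} (e : Fin (n / 2) × Fin 2 ≃ Fin n) {y b : ℝ} (hy₀ : 0 ≤ y)
    (hy₁ : y ≤ 2 / 3) (hb₀ : 0 ≤ b) (hb₁ : b ≤ 1) (T : Finset (Fin n)) (g : Fin (n / 2)) :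
    spreadProb e y T g * ((1 + b) * (1 + b)) + (1 - spreadProb e y T g) * (1 * 1)
      ≤ (if e (g, 0) ∈ T then 1 + (1 - y) * b else 1) *
        (if e (g, 1) ∈ T then 1 + (1 - y) * b else 1) := by
  have h1 : 0 ≤ (1 - y) * b := mul_nonneg (by linarith) hb₀
  have h2 : 0 ≤ (1 - y) * b * (1 - b) := mul_nonneg h1 (by linarith)
  have h3 : 0 ≤ (1 - y) * b * (y * (6 - 2 * b)) :=
    mul_nonneg h1 (mul_nonneg hy₀ (by linarith))
  simp only [spreadProb, siteTotal]
  split_ifs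
  · linear_combination h3 / 5
  · nlinarith
  · nlinarith
  · nlinarith

lemma spreadProb_nonneg {n : ℕ} (e : Fin (n / 2) × Fin 2 ≃ Fin n) {y : ℝ} (hy₁ : y ≤ 2 / 3)
    (T : Finset (Fin n)) (g : Fin (n / 2)) : 0 ≤ spreadProb e y T g := by
  have h : ∀ i, 1 ≤ siteTotal y T i := fun i => by
    unfold siteTotal; split_ifs <;> linarith
  have := one_le_mul_of_one_le_of_one_le (h (e (g, 0))) (h (e (g, 1)))
  unfold spreadProb
  linarith

lemma spreadProb_le_one {n : ℕ} (e : Fin (n / 2) × Fin 2 ≃ Fin n) {y : ℝ} (hy₀ : 0 ≤ y)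
    (hy₁ : y ≤ 2 / 3) (T : Finset (Fin n)) (g : Fin (n / 2)) : spreadProb e y T g ≤ 1 := by
  have h : ∀ i, 1 ≤ siteTotal y T i := fun i => by
    unfold siteTotal; split_ifs <;> linarith
  have h4 : ∀ i, siteTotal y T i ≤ 4 := fun i => by
    unfold siteTotal; split_ifs <;> linarith
  have := mul_le_mul (h4 (e (g, 0))) (h4 (e (g, 1))) (by linarith [h (e (g, 1))]) (by norm_num)
  unfold spreadProb
  linarith

/-- The contraction of the second moment. A layer of noise and gates turns the indicator of the
strings supported in `T` into a mixture of such indicators, for random unions of pairs. -/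
lemma zIndicator_dotProduct_le {n : ℕ} {y : ℝ} (hy₀ : 0 ≤ y) (hy₁ : y ≤ 2 / 3) : ∀ {d : ℕ}
    (e : Fin d → (Fin (n / 2) × Fin 2 ≃ Fin n)) (T : Finset (Fin n)),
    zIndicator ⬝ᵥ (meanTransferMatrix y e).mulVec (noisySupport y T)
      ≤ ∏ i, if i ∈ T then 1 + (1 - y) ^ d else 1 := by
  intro d
  induction d with
  | zero =>
    intro e T
    rw [meanTransferMatrix, Matrix.one_mulVec]
    simp only [dotProduct, zIndicator, noisySupport, supportIndicator, ← Finset.prod_mul_distrib]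
    have h := Finset.prod_univ_sum (fun _ : Fin n => (Finset.univ : Finset (Fin 4)))
      fun i a => (if a = 0 ∨ a = 3 then (1 : ℝ) else 0) *
        (siteWeight y a * if i ∈ T then 1 else if a = 0 then 1 else 0)
    rw [Fintype.piFinset_univ] at h
    rw [← h]
    refine le_of_eq (Finset.prod_congr rfl fun i _ => ?_)
    by_cases hi : i ∈ T <;> simp [Fin.sum_univ_four, siteWeight, hi]
  | succ d ih =>
    intro e T
    have hb₀ : 0 ≤ (1 - y) ^ d := pow_nonneg (by linarith) d
    have hb₁ : (1 - y) ^ d ≤ 1 := pow_le_one₀ (by linarith) (by linarith)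
    have hdiag : ∀ S : Finset (Fin n), (Matrix.diagonal fun P : PauliString n =>
        ∏ i, siteWeight y (P i)).mulVec (supportIndicator S) = noisySupport y S := fun S => by
      ext P; rw [Matrix.mulVec_diagonal, noisySupport]
    rw [meanTransferMatrix, ← Matrix.mulVec_mulVec, ← Matrix.mulVec_mulVec,
      mixMatrix_mulVec_noisySupport]
    simp only [Matrix.mulVec_sum, Matrix.mulVec_smul, hdiag, dotProduct_sum, dotProduct_smul,
      smul_eq_mul]
    calc _ ≤ ∑ G : Finset (Fin (n / 2)), ((∏ g ∈ G, spreadProb (e 0) y T g) *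
          ∏ g ∈ Finset.univ \ G, (1 - spreadProb (e 0) y T g)) *
          ∏ i, (if i ∈ sitesOf (e 0) G then 1 + (1 - y) ^ d else 1) := by
          refine Finset.sum_le_sum fun G _ => mul_le_mul_of_nonneg_left (ih _ _) ?_
          exact mul_nonneg (Finset.prod_nonneg fun g _ => spreadProb_nonneg _ hy₁ _ _)
            (Finset.prod_nonneg fun g _ => sub_nonneg.2 (spreadProb_le_one _ hy₀ hy₁ _ _))
      _ = ∏ g, (spreadProb (e 0) y T g * ((1 + (1 - y) ^ d) * (1 + (1 - y) ^ d)) +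
            (1 - spreadProb (e 0) y T g) * (1 * 1)) := by
          rw [Finset.prod_add, Finset.powerset_univ]
          refine Finset.sum_congr rfl fun G _ => ?_
          rw [prod_sitesOf (e 0) G (fun _ => 1 + (1 - y) ^ d) (fun _ => 1)]
          simp only [Finset.prod_mul_distrib]
          ring
      _ ≤ ∏ g, ((if e 0 (g, 0) ∈ T then 1 + (1 - y) * (1 - y) ^ d else 1) *
            (if e 0 (g, 1) ∈ T then 1 + (1 - y) * (1 - y) ^ d else 1)) := by
          refine Finset.prod_le_prod (fun g _ => ?_) fun g _ => spread_le _ hy₀ hy₁ hb₀ hb₁ _ _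
          have h1 := spreadProb_nonneg (e 0) hy₁ T g
          have h2 := spreadProb_le_one (e 0) hy₀ hy₁ T g
          have h3 : 0 ≤ 1 - spreadProb (e 0) y T g := by linarith
          positivity
      _ = _ := by
          rw [prod_eq_prod_pairs (e 0)]
          simp only [pow_succ']

lemma siteWeight_nonneg {y : ℝ} (hy₁ : y ≤ 2 / 3) (a : Fin 4) : 0 ≤ siteWeight y a := by
  unfold siteWeight; split_ifs <;> linarith

lemma mixKernel_nonneg (a b : Fin 4 × Fin 4) : 0 ≤ mixKernel a b := by
  unfold mixKernel; split_ifs <;> norm_num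

lemma meanTransferMatrix_nonneg {n : ℕ} {y : ℝ} (hy₁ : y ≤ 2 / 3) : ∀ {d : ℕ}
    (e : Fin d → (Fin (n / 2) × Fin 2 ≃ Fin n)) (P P' : PauliString n),
    0 ≤ meanTransferMatrix y e P P' := by
  intro d
  induction d with
  | zero =>
    intro e P P'
    rw [meanTransferMatrix, Matrix.one_apply]
    split_ifs <;> norm_num
  | succ d ih =>
    intro e P P'
    rw [meanTransferMatrix, Matrix.mul_apply]
    refine Finset.sum_nonneg fun P'' _ => mul_nonneg (ih _ _ _) ?_
    rw [Matrix.diagonal_mul, mixMatrix, Matrix.of_apply]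
    exact mul_nonneg (Finset.prod_nonneg fun i _ => siteWeight_nonneg hy₁ _)
      (Finset.prod_nonneg fun g _ => mixKernel_nonneg _ _)

lemma pauliCoeff_zeroState {n : ℕ} (P : PauliString n) :
    pauliCoeff P (zeroState n) = (zIndicator P : ℂ) := by
  have h : ∀ a : Fin 4, pauli a 0 0 = ((if a = 0 ∨ a = 3 then 1 else 0 : ℝ) : ℂ) := by
    intro a
    fin_cases a <;> simp [pauli]
  rw [pauliCoeff, zeroState, Matrix.trace_mul_single]
  simp only [pauliMatrix, Matrix.of_apply, Pi.zero_apply, h, zIndicator]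
  push_cast
  simp

lemma zIndicator_sq {n : ℕ} (P : PauliString n) : zIndicator P * zIndicator P = zIndicator P := by
  rw [zIndicator, ← Finset.prod_mul_distrib]
  refine Finset.prod_congr rfl fun i _ => ?_
  split_ifs <;> norm_num

lemma zIndicator_nonneg {n : ℕ} (P : PauliString n) : 0 ≤ zIndicator P :=
  Finset.prod_nonneg fun i _ => by split_ifs <;> norm_num

/-- Noise does not affect `1` and `Z`, so the input state is dominated by a noisy one. -/
lemma zIndicator_le_noisySupport {n : ℕ} {y : ℝ} (hy₁ : y ≤ 2 / 3) (P : PauliString n) :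
    zIndicator P ≤ noisySupport y Finset.univ P := by
  rw [zIndicator, noisySupport, supportIndicator]
  simp only [Finset.mem_univ, if_true, Finset.prod_const_one, mul_one]
  refine Finset.prod_le_prod (fun i _ => by split_ifs <;> norm_num) fun i _ => ?_
  unfold siteWeight
  have : ∀ a : Fin 4, (a = 0 ∨ a = 3) → ¬ (a = 1 ∨ a = 2) := by decide
  by_cases h : P i = 0 ∨ P i = 3
  · simp [h, this _ h]
  · rw [if_neg h]; split_ifs <;> linarith

/-! ### From Pauli strings to the output distribution -/

/-- Parseval's identity for the diagonal of an operator. -/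
lemma sum_zIndicator_normSq {n : ℕ} (ρ : QMatrix n) :
    ∑ P, zIndicator P * Complex.normSq (pauliCoeff P ρ) = 2 ^ n * ∑ x, Complex.normSq (ρ x x) := by
  have hsite : ∀ s t s' t' : Fin 2, ∑ a : Fin 4, (if a = 0 ∨ a = 3 then (1 : ℂ) else 0) *
      (pauli a s t * star (pauli a s' t')) = if t = s ∧ s' = s ∧ t' = s then 2 else 0 := by
    intro s t s' t'
    fin_cases s <;> fin_cases t <;> fin_cases s' <;> fin_cases t' <;>
      simp [pauli, Fin.sum_univ_four] <;> norm_num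
  -- The sum over the strings selects the diagonal entries, site by site.
  have hstring : ∀ s t s' t' : Bits n, ∑ P : PauliString n, (zIndicator P : ℂ) *
      (pauliMatrix P s t * star (pauliMatrix P s' t'))
        = if t = s ∧ s' = s ∧ t' = s then 2 ^ n else 0 := by
    intro s t s' t'
    have h := Finset.prod_univ_sum (fun _ : Fin n => (Finset.univ : Finset (Fin 4)))
      fun i a => (if a = 0 ∨ a = 3 then (1 : ℂ) else 0) *
      (pauli a (s i) (t i) * star (pauli a (s' i) (t' i)))
    rw [Fintype.piFinset_univ] at h
    simp only [zIndicator, pauliMatrix, Matrix.of_apply, star_prod, Complex.ofReal_prod,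
      ← Finset.prod_mul_distrib]
    have hc : ∀ a : Fin 4, (((if a = 0 ∨ a = 3 then 1 else 0 : ℝ)) : ℂ)
        = if a = 0 ∨ a = 3 then 1 else 0 := fun a => by split_ifs <;> simp
    simp only [hc]
    rw [← h]
    simp only [hsite]
    split_ifs with hst
    · obtain ⟨rfl, rfl, rfl⟩ := hst
      simp
    · obtain ⟨i, hi⟩ : ∃ i, ¬ (t i = s i ∧ s' i = s i ∧ t' i = s i) := by
        by_contra! hcon
        exact hst ⟨funext fun i => (hcon i).1, funext fun i => (hcon i).2.1,
          funext fun i => (hcon i).2.2⟩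
      exact Finset.prod_eq_zero (Finset.mem_univ i) (if_neg hi)
  rw [← Complex.ofReal_inj]
  push_cast
  have hcoef : ∀ P : PauliString n, ((Complex.normSq (pauliCoeff P ρ) : ℝ) : ℂ)
      = ∑ x : Bits n × Bits n, ∑ y : Bits n × Bits n,
        (pauliMatrix P x.1 x.2 * star (pauliMatrix P y.1 y.2)) *
        (ρ x.2 x.1 * star (ρ y.2 y.1)) := by
    intro P
    have hc : pauliCoeff P ρ = ∑ x : Bits n × Bits n, pauliMatrix P x.1 x.2 * ρ x.2 x.1 := by
      rw [Fintype.sum_prod_type]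
      rfl
    rw [← Complex.mul_conj, starRingEnd_apply, hc, star_sum, Finset.sum_mul_sum]
    refine Finset.sum_congr rfl fun x _ => Finset.sum_congr rfl fun y _ => ?_
    rw [star_mul']
    ring
  simp only [hcoef, Finset.mul_sum]
  rw [Finset.sum_comm, Fintype.sum_prod_type]
  have hxy : ∀ x y : Bits n × Bits n, ∑ P : PauliString n, (zIndicator P : ℂ) *
      ((pauliMatrix P x.1 x.2 * star (pauliMatrix P y.1 y.2)) * (ρ x.2 x.1 * star (ρ y.2 y.1)))
      = (if x.2 = x.1 ∧ y.1 = x.1 ∧ y.2 = x.1 then 2 ^ n else 0) *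
        (ρ x.2 x.1 * star (ρ y.2 y.1)) := by
    intro x y
    simp only [← mul_assoc _ _ (ρ _ _ * _), ← Finset.sum_mul, hstring]
  refine Finset.sum_congr rfl fun s _ => ?_
  rw [Finset.sum_eq_single s, Finset.sum_comm, Finset.sum_eq_single (s, s), hxy, if_pos (by simp),
    ← starRingEnd_apply, Complex.mul_conj]
  · intro y _ hy
    rw [hxy, if_neg, zero_mul]
    rintro ⟨-, h1, h2⟩
    exact hy (Prod.ext h1 h2)
  · simp
  · intro t _ ht
    rw [Finset.sum_comm]
    refine Finset.sum_eq_zero fun y _ => ?_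
    rw [hxy, if_neg, zero_mul]
    exact fun h => ht h.1
  · simp

/-! ### The output is a state -/

lemma pauliMatrix_zero {n : ℕ} : pauliMatrix (0 : PauliString n) = 1 := by
  have h : pauli 0 = 1 := rfl
  ext s t
  simp only [pauliMatrix, Matrix.of_apply, Pi.zero_apply, h, Matrix.one_apply,
    Finset.prod_ite_zero]
  simp [funext_iff]

lemma pauliCoeff_zero {n : ℕ} (ρ : QMatrix n) : pauliCoeff 0 ρ = ρ.trace := by
  rw [pauliCoeff, pauliMatrix_zero, one_mul]

lemma layerUnitary_conjTranspose_mul_self {n : ℕ} (e : Fin (n / 2) × Fin 2 ≃ Fin n)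
    (u : Fin (n / 2) → TwoQubitGate) :
    (layerUnitary e u).conjTranspose * layerUnitary e u = 1 := by
  rw [layerUnitary_eq_pairTensor, pairTensor_conjTranspose, pairTensor_mul, ← pauliMatrix_zero,
    pauliMatrix_eq_pairTensor e]
  congr 1
  ext1 g
  have h : pairEquiv e (Fin 4) 0 g = 0 := rfl
  rw [h, pauli₂_zero]
  exact Matrix.mem_unitaryGroup_iff'.1 (u g).2

lemma trace_layerStep {n : ℕ} (e : Fin (n / 2) × Fin 2 ≃ Fin n) (q : ℝ)
    (u : Fin (n / 2) → TwoQubitGate) (L : Fin n → Bool) (ρ : QMatrix n) :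
    (layerStep e q u L ρ).trace = ρ.trace := by
  rw [layerStep, ← pauliCoeff_zero, pauliCoeff_noiseLayer, pauliCoeff_zero, Matrix.trace_mul_comm,
    ← Matrix.mul_assoc, layerUnitary_conjTranspose_mul_self, Matrix.one_mul]
  simp [dephaseFactor]

lemma posSemidef_dephase {n : ℕ} {q : ℝ} (hq₀ : 0 ≤ q) (hq₁ : q ≤ 1) (i : Fin n)
    {ρ : QMatrix n} (hρ : ρ.PosSemidef) : (dephase q i ρ).PosSemidef := by
  have hZ : (pauliZ i : QMatrix n).conjTranspose = pauliZ i := by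
    rw [pauliZ, Matrix.diagonal_conjTranspose]
    congr 1
    ext x
    simp only [Pi.star_apply]
    split_ifs <;> simp
  have h := hρ.mul_mul_conjTranspose_same (pauliZ i)
  rw [hZ] at h
  exact (hρ.smul (by exact_mod_cast sub_nonneg.2 hq₁)).add (h.smul (by exact_mod_cast hq₀))

lemma posSemidef_layerStep {n : ℕ} (e : Fin (n / 2) × Fin 2 ≃ Fin n) {q : ℝ} (hq₀ : 0 ≤ q)
    (hq₁ : q ≤ 1) (u : Fin (n / 2) → TwoQubitGate) (L : Fin n → Bool) {ρ : QMatrix n}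
    (hρ : ρ.PosSemidef) : (layerStep e q u L ρ).PosSemidef := by
  have h : ∀ (l : List (Fin n)) (ρ : QMatrix n), ρ.PosSemidef →
      (l.foldl (fun σ i => if L i then dephase q i σ else σ) ρ).PosSemidef := by
    intro l
    induction l with
    | nil => exact fun ρ hρ => hρ
    | cons i l ih =>
      intro ρ hρ
      refine ih _ ?_
      dsimp only
      split_ifs
      · exact posSemidef_dephase hq₀ hq₁ i hρ
      · exact hρ
  exact h _ _ (hρ.mul_mul_conjTranspose_same _)

lemma circuitRun_posSemidef_and_trace {n : ℕ} {q : ℝ} (hq₀ : 0 ≤ q) (hq₁ : q ≤ 1) : ∀ {d : ℕ}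
    (e : Fin d → (Fin (n / 2) × Fin 2 ≃ Fin n)) (u : Gates n d) (L : Locations n d)
    {ρ : QMatrix n}, ρ.PosSemidef →
    (circuitRun e q u L ρ).PosSemidef ∧ (circuitRun e q u L ρ).trace = ρ.trace := by
  intro d
  induction d with
  | zero => intro e u L ρ hρ; exact ⟨hρ, rfl⟩
  | succ d ih =>
    intro e u L ρ hρ
    rw [circuitRun_succ]
    have h := ih (fun m => e m.succ) (fun m => u m.succ) (fun m => L m.succ)
      (posSemidef_layerStep (e 0) hq₀ hq₁ (u 0) (L 0) hρ)
    exact ⟨h.1, h.2.trans (trace_layerStep _ _ _ _ _)⟩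

lemma outputState_posSemidef_and_trace {n d : ℕ} (A : ParallelArchitecture n d) {q : ℝ}
    (hq₀ : 0 ≤ q) (hq₁ : q ≤ 1) (u : Gates n d) (L : Locations n d) :
    (outputState A q u L).PosSemidef ∧ (outputState A q u L).trace = 1 := by
  have h0 : (zeroState n).PosSemidef := by
    have h : zeroState n = Matrix.vecMulVec (Pi.single 0 1) (star (Pi.single 0 1)) := by
      ext x y
      by_cases hx : x = 0 <;> by_cases hy : y = 0 <;>
        simp [zeroState, Matrix.vecMulVec_apply, @eq_comm _ (0 : Bits n), hx, hy]
    rw [h]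
    exact Matrix.posSemidef_vecMulVec_self_star _
  have h := circuitRun_posSemidef_and_trace hq₀ hq₁ A.site u L h0
  rw [outputState_eq_circuitRun]
  exact ⟨h.1, h.2.trans (by simp [zeroState])⟩

/-! ### The total variation distance -/

lemma sum_outputProb {n d : ℕ} (A : ParallelArchitecture n d) {q : ℝ}
    (hq₀ : 0 ≤ q) (hq₁ : q ≤ 1) (u : Gates n d) (L : Locations n d) :
    ∑ x, outputProb A q u L x = 1 := by
  have h := congrArg Complex.re (outputState_posSemidef_and_trace A hq₀ hq₁ u L).2
  simpa [Matrix.trace, outputProb] using h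

lemma tvDistUniform_nonneg {n d : ℕ} (A : ParallelArchitecture n d) (q : ℝ) (u : Gates n d)
    (L : Locations n d) : 0 ≤ tvDistUniform A q u L := by
  unfold tvDistUniform
  positivity

lemma tvDistUniform_le_one {n d : ℕ} (A : ParallelArchitecture n d) {q : ℝ}
    (hq₀ : 0 ≤ q) (hq₁ : q ≤ 1) (u : Gates n d) (L : Locations n d) :
    tvDistUniform A q u L ≤ 1 := by
  have hpos : ∀ x, 0 ≤ outputProb A q u L x := fun x =>
    (Complex.nonneg_iff.1 ((outputState_posSemidef_and_trace A hq₀ hq₁ u L).1.diag_nonneg)).1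
  have h : ∑ x, |outputProb A q u L x - 1 / 2 ^ n|
      ≤ ∑ x : Bits n, (outputProb A q u L x + 1 / 2 ^ n) := by
    refine Finset.sum_le_sum fun x _ => (abs_sub _ _).trans_eq ?_
    rw [abs_of_nonneg (hpos x), abs_of_nonneg (by positivity)]
  rw [Finset.sum_add_distrib, sum_outputProb A hq₀ hq₁] at h
  simp at h
  unfold tvDistUniform
  simp only [one_div] at h ⊢
  linarith

/-- The second moment controls the distance, by the Cauchy–Schwarz inequality. -/
lemma four_mul_tvDistUniform_sq_le {n d : ℕ} (A : ParallelArchitecture n d) {q : ℝ}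
    (hq₀ : 0 ≤ q) (hq₁ : q ≤ 1) (u : Gates n d) (L : Locations n d) :
    4 * tvDistUniform A q u L ^ 2
      ≤ ∑ P, zIndicator P * Complex.normSq (pauliCoeff P (outputState A q u L)) - 1 := by
  have h1 : (∑ x, |outputProb A q u L x - 1 / 2 ^ n|) ^ 2
      ≤ 2 ^ n * ∑ x, (outputProb A q u L x - 1 / 2 ^ n) ^ 2 := by
    have h := sq_sum_le_card_mul_sum_sq (s := (Finset.univ : Finset (Bits n)))
      (f := fun x => |outputProb A q u L x - 1 / 2 ^ n|)
    simpa [sq_abs] using h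
  have h2 : 2 ^ n * ∑ x, (outputProb A q u L x - 1 / 2 ^ n) ^ 2
      = 2 ^ n * ∑ x, outputProb A q u L x ^ 2 - 1 := by
    have h3 : ∀ x, (outputProb A q u L x - 1 / 2 ^ n) ^ 2
        = outputProb A q u L x ^ 2 - 2 / 2 ^ n * outputProb A q u L x + (1 / 2 ^ n) ^ 2 := by
      intro x; ring
    simp only [h3, Finset.sum_add_distrib, Finset.sum_sub_distrib, ← Finset.mul_sum,
      sum_outputProb A hq₀ hq₁]
    have h4 : ∑ _x : Bits n, ((1 : ℝ) / 2 ^ n) ^ 2 = 1 / 2 ^ n := by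
      simp [sq]
    rw [h4]
    field_simp
    ring
  have h5 : ∑ x, outputProb A q u L x ^ 2 ≤ ∑ x, Complex.normSq (outputState A q u L x x) := by
    refine Finset.sum_le_sum fun x _ => ?_
    rw [outputProb, Complex.normSq_apply]
    nlinarith [mul_self_nonneg (outputState A q u L x x).im]
  rw [sum_zIndicator_normSq]
  have h6 := mul_le_mul_of_nonneg_left h5 (by positivity : (0 : ℝ) ≤ 2 ^ n)
  rw [tvDistUniform]
  linarith

lemma continuous_outputState {n d : ℕ} (A : ParallelArchitecture n d) (q : ℝ)
    (L : Locations n d) : Continuous fun u : Gates n d => outputState A q u L :=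
  (continuous_circuitRun q A.site L).comp
    (f := fun u : Gates n d => (u, zeroState n)) (by fun_prop)

lemma continuous_tvDistUniform {n d : ℕ} (A : ParallelArchitecture n d) (q : ℝ)
    (L : Locations n d) : Continuous fun u : Gates n d => tvDistUniform A q u L := by
  have h : ∀ x, Continuous fun u : Gates n d => outputProb A q u L x := fun x =>
    Complex.continuous_re.comp ((continuous_outputState A q L).matrix_elem x x)
  unfold tvDistUniform
  fun_prop

lemma integrable_tvDistUniform {n d : ℕ} (A : ParallelArchitecture n d) {q : ℝ}
    (hq₀ : 0 ≤ q) (hq₁ : q ≤ 1) (p : unitInterval) :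
    Integrable (fun c : Gates n d × Locations n d => tvDistUniform A q c.1 c.2)
      (ensemble n d p) := by
  have hm : Measurable fun c : Gates n d × Locations n d => tvDistUniform A q c.1 c.2 :=
    measurable_from_prod_countable_left fun L => (continuous_tvDistUniform A q L).measurable
  refine Integrable.of_bound hm.aestronglyMeasurable 1 (Filter.Eventually.of_forall fun c => ?_)
  rw [Real.norm_of_nonneg (tvDistUniform_nonneg _ _ _ _)]
  exact tvDistUniform_le_one A hq₀ hq₁ _ _

/-! ### The mean distance -/

lemma integrable_secondMoment {n d : ℕ} (A : ParallelArchitecture n d) (q : ℝ)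
    (L : Locations n d) (P : PauliString n) :
    Integrable (fun u => Complex.normSq (pauliCoeff P (outputState A q u L))) (gateLaw n d) :=
  Continuous.integrable_of_hasCompactSupport
    (Complex.continuous_normSq.comp
      ((continuous_pauliCoeff P).comp (continuous_outputState A q L)))
    (HasCompactSupport.of_compactSpace _)

/-- A bound on the mean of `2ⁿ ∑ₓ |⟨x|ρ|x⟩|²`, in its form given by Parseval's identity. -/
lemma integral_secondMoment_le {n d : ℕ} (A : ParallelArchitecture n d) (p q : unitInterval) :
    ∫ L, ∫ u, ∑ P, zIndicator P * Complex.normSq (pauliCoeff P (outputState A (q : ℝ) u L))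
      ∂(gateLaw n d) ∂(locationLaw n d p)
      ≤ (1 + (1 - 8 * (q : ℝ) * (1 - q) / 3 * p) ^ d) ^ n := by
  have hq : 0 ≤ 8 * (q : ℝ) * (1 - q) / 3 := by
    have := mul_nonneg q.2.1 (sub_nonneg.2 q.2.2)
    linarith
  have hy₀ : 0 ≤ 8 * (q : ℝ) * (1 - q) / 3 * p := mul_nonneg hq p.2.1
  have hy₁ : 8 * (q : ℝ) * (1 - q) / 3 * p ≤ 2 / 3 := by
    have h1 : 8 * (q : ℝ) * (1 - q) / 3 ≤ 2 / 3 := by nlinarith [sq_nonneg (2 * (q : ℝ) - 1)]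
    exact (mul_le_of_le_one_right hq p.2.2).trans h1
  have hin : ∀ P (L : Locations n d),
      ∫ u, Complex.normSq (pauliCoeff P (outputState A (q : ℝ) u L)) ∂(gateLaw n d)
        = ∑ P', transferMatrix (q : ℝ) A.site L P P' * zIndicator P' := by
    intro P L
    simp only [outputState_eq_circuitRun]
    rw [integral_normSq_pauliCoeff_circuitRun]
    simp only [Matrix.mulVec, dotProduct, pauliCoeff_zeroState, Complex.normSq_ofReal,
      zIndicator_sq]
  have hL : ∀ L : Locations n d,
      ∫ u, ∑ P, zIndicator P * Complex.normSq (pauliCoeff P (outputState A (q : ℝ) u L))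
        ∂(gateLaw n d)
      = ∑ P, zIndicator P * ∑ P', transferMatrix (q : ℝ) A.site L P P' * zIndicator P' := by
    intro L
    rw [integral_finsetSum _ fun P _ => (integrable_secondMoment A q L P).const_mul _]
    simp only [integral_const_mul, hin]
  simp only [hL]
  rw [integral_finsetSum _ fun _ _ => Integrable.of_finite]
  simp only [integral_const_mul]
  simp only [integral_finsetSum _ fun _ _ => Integrable.of_finite, integral_mul_const,
    integral_transferMatrix]
  refine le_trans ?_ ((zIndicator_dotProduct_le hy₀ hy₁ A.site Finset.univ).trans_eq ?_)
  · refine Finset.sum_le_sum fun P _ => mul_le_mul_of_nonneg_left ?_ (zIndicator_nonneg P)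
    exact Finset.sum_le_sum fun P' _ => mul_le_mul_of_nonneg_left
      (zIndicator_le_noisySupport hy₁ P') (meanTransferMatrix_nonneg hy₁ _ _ _)
  · simp

/-- A bound on the mean distance, by the arithmetic–geometric mean inequality with an
arbitrary weight `r`. -/
lemma integral_tvDistUniform_le {n d : ℕ} (A : ParallelArchitecture n d) (p q : unitInterval)
    {r : ℝ} (hr : 0 < r) :
    ∫ c, tvDistUniform A (q : ℝ) c.1 c.2 ∂(ensemble n d p)
      ≤ (((1 + (1 - 8 * (q : ℝ) * (1 - q) / 3 * p) ^ d) ^ n - 1) / r + r) / 4 := by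
  have hint := integrable_tvDistUniform A q.2.1 q.2.2 p
  rw [ensemble] at hint ⊢
  rw [integral_prod_symm _ hint]
  set F : Gates n d → Locations n d → ℝ := fun u L =>
    ∑ P, zIndicator P * Complex.normSq (pauliCoeff P (outputState A (q : ℝ) u L)) with hF
  have hFint : ∀ L, Integrable (fun u => F u L) (gateLaw n d) := fun L =>
    integrable_finsetSum _ fun P _ => (integrable_secondMoment A q L P).const_mul _
  have hpt : ∀ u L, tvDistUniform A (q : ℝ) u L ≤ ((F u L - 1) / r + r) / 4 := by
    intro u L
    have h := four_mul_tvDistUniform_sq_le A q.2.1 q.2.2 u L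
    rw [le_div_iff₀ (by norm_num : (0 : ℝ) < 4), ← sub_le_iff_le_add, le_div_iff₀ hr]
    nlinarith [sq_nonneg (2 * tvDistUniform A (q : ℝ) u L - r)]
  have hu : ∀ L, ∫ u, tvDistUniform A (q : ℝ) u L ∂(gateLaw n d)
      ≤ ((∫ u, F u L ∂(gateLaw n d) - 1) / r + r) / 4 := by
    intro L
    have h1 : Integrable (fun u => ((F u L - 1) / r + r) / 4) (gateLaw n d) :=
      ((((hFint L).sub (integrable_const 1)).div_const r).add (integrable_const r)).div_const 4
    refine (integral_mono ((continuous_tvDistUniform A q L).integrable_of_hasCompactSupport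
      (HasCompactSupport.of_compactSpace _)) h1 fun u => hpt u L).trans_eq ?_
    have h2 : Integrable (fun u => (F u L - 1) / r) (gateLaw n d) :=
      ((hFint L).sub (integrable_const 1)).div_const r
    rw [integral_div, integral_add h2 (integrable_const r), integral_div,
      integral_sub (hFint L) (integrable_const 1)]
    simp
  refine (integral_mono Integrable.of_finite Integrable.of_finite hu).trans ?_
  rw [integral_div, integral_add Integrable.of_finite Integrable.of_finite, integral_div,
    integral_sub Integrable.of_finite Integrable.of_finite]
  have h := integral_secondMoment_le A p q
  simp only [integral_const, probReal_univ, one_smul]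
  gcongr

end NoisyCircuit
end

theorem mainTheorem2 (n d : ℕ) (hn : 0 < n) (hn2 : Even n)
    (A : NoisyCircuit.ParallelArchitecture n d) (p q : unitInterval) (γ : ℝ) (hγ : γ = 8 * (q : ℝ) * (1 - (q : ℝ)) / 3) :
    Integrable (fun c : NoisyCircuit.Gates n d × NoisyCircuit.Locations n d =>
        NoisyCircuit.tvDistUniform A (q : ℝ) c.1 c.2) (NoisyCircuit.ensemble n d p) ∧
      ∫ c, NoisyCircuit.tvDistUniform A (q : ℝ) c.1 c.2 ∂(NoisyCircuit.ensemble n d p) <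
        (3 : ℝ) ^ (2 / 3 : ℝ) / 2 * (n : ℝ) ^ (1 / 3 : ℝ) *
          Real.exp (-(γ * (p : ℝ) * (d : ℝ)) / 3) := by
  have hint := NoisyCircuit.integrable_tvDistUniform A q.2.1 q.2.2 p
  refine ⟨hint, ?_⟩
  have hn' : (0 : ℝ) < n := by exact_mod_cast hn
  set r : ℝ := (3 : ℝ) ^ (2 / 3 : ℝ) * (n : ℝ) ^ (1 / 3 : ℝ) *
    Real.exp (-(γ * (p : ℝ) * (d : ℝ)) / 3) with hr_def
  have hr : 0 < r := by positivity
  set x : ℝ := n * Real.exp (-(γ * p * d)) with hx_def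
  have hr3 : r ^ 3 = 9 * x := by
    rw [hr_def, mul_pow, mul_pow, ← Real.rpow_natCast, ← Real.rpow_natCast, ← Real.rpow_mul,
      ← Real.rpow_mul, ← Real.exp_nat_mul, hx_def]
    · norm_num
      rw [show 3 * (-(γ * (p : ℝ) * d) / 3) = -(γ * p * d) by ring]
      ring
    · positivity
    · norm_num
  have hgoal : (3 : ℝ) ^ (2 / 3 : ℝ) / 2 * (n : ℝ) ^ (1 / 3 : ℝ) *
      Real.exp (-(γ * (p : ℝ) * (d : ℝ)) / 3) = r / 2 := by rw [hr_def]; ring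
  rw [hgoal]
  rcases lt_or_ge 2 r with hr2 | hr2
  · -- The bound exceeds one, and a total variation distance does not.
    have h1 : ∫ c, NoisyCircuit.tvDistUniform A (q : ℝ) c.1 c.2 ∂(NoisyCircuit.ensemble n d p)
        ≤ ∫ _, (1 : ℝ) ∂(NoisyCircuit.ensemble n d p) :=
      integral_mono hint (integrable_const 1) fun c =>
        NoisyCircuit.tvDistUniform_le_one A q.2.1 q.2.2 _ _
    simp only [integral_const, probReal_univ, one_smul] at h1
    linarith
  · -- Here `x ≤ 8 / 9`, and the second moment is at most `exp x ≤ 1 + 2 x`.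
    have hx₀ : 0 < x := by positivity
    have hx₁ : x ≤ 1 := by
      have : r ^ 3 ≤ 2 ^ 3 := by gcongr
      linarith
    have hle := NoisyCircuit.integral_tvDistUniform_le A p q hr
    rw [← hγ] at hle
    have hq : 0 ≤ γ := by
      have := mul_nonneg q.2.1 (sub_nonneg.2 q.2.2)
      rw [hγ]; linarith
    have hbase : 0 ≤ 1 - γ * p := by
      have h1 : γ ≤ 2 / 3 := by rw [hγ]; nlinarith [sq_nonneg (2 * (q : ℝ) - 1)]
      have h2 : γ * p ≤ γ := mul_le_of_le_one_right hq p.2.2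
      linarith
    have hdecay : (1 - γ * (p : ℝ)) ^ d ≤ Real.exp (-(γ * p * d)) := by
      have h1 : 1 - γ * (p : ℝ) ≤ Real.exp (-(γ * p)) := Real.one_sub_le_exp_neg _
      refine (pow_le_pow_left₀ hbase h1 d).trans_eq ?_
      rw [← Real.exp_nat_mul]
      ring_nf
    have hmom : (1 + (1 - γ * (p : ℝ)) ^ d) ^ n ≤ Real.exp x := by
      have h1 : 1 + (1 - γ * (p : ℝ)) ^ d ≤ Real.exp (Real.exp (-(γ * p * d))) := by
        have := Real.add_one_le_exp (Real.exp (-(γ * (p : ℝ) * d)))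
        linarith
      refine (pow_le_pow_left₀ (by positivity) h1 n).trans_eq ?_
      rw [← Real.exp_nat_mul]
    have hexp : Real.exp x ≤ 1 + 2 * x := by
      have h := (abs_le.1 (Real.abs_exp_sub_one_sub_id_le (x := x)
        (abs_le.2 ⟨by linarith, hx₁⟩))).2
      nlinarith
    -- The target bound is `r / 2`, and `(2 x / r + r) / 4 < r / 2` because `r < 9 / 2`.
    have hdiv : ((1 + (1 - γ * (p : ℝ)) ^ d) ^ n - 1) / r ≤ 2 * r ^ 2 / 9 := by
      rw [div_le_iff₀ hr]
      have : 2 * r ^ 2 / 9 * r = 2 * x := by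
        rw [show 2 * r ^ 2 / 9 * r = 2 * r ^ 3 / 9 by ring, hr3]; ring
      linarith
    nlinarith
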